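/- Let $n=3$ and $s\in(0,1)$. For $\xi\in\mathbb R^m$ write $\langle\xi\rangle=(1+|\xi|^2)^{1/2}$, let $\mathcal F$ be the Fourier transform with kernel $e^{-ix\cdot\xi}$ (also written $\widehat u=\mathcal F u$; on $L^2$ and on tempered distributions it is the usual extension), and let $D=-i\partial$. For a vector field $u$ on $\mathbb R^n$ with values in $\mathbb R^3$ (or $\mathbb C^3$) the adjoint fractional curl is the two-point field $$\mathcal C^*u(x,y)=\alpha(x,y)\times\big(u(y)-u(x)\big),\qquad \alpha(x,y)=\frac{C_{n,s}^{1/2}}{\sqrt2}\,\frac{y-x}{|y-x|^{n/2+s+1}},\qquad C_{n,s}=\frac{2^s\,\Gamma(\frac{n+s}2)}{\pi^{n/2}\,|\Gamma(-\frac s2)|}.$$ For $r\in\mathbb R$ let $H^r(\mathbb R^m)$ be the space of tempered distributions $f$ with $\langle D\rangle^r f\in L^2(\mathbb R^m)$, normed by $\|\langle D\rangle^r f\|_{L^2}$. For $t\in\mathbb R$ let $\langle D_x+D_y\rangle^{t}L^2(\mathbb R^{2n})$ denote the space of tempered distributions $f$ on $\mathbb R^{2n}$ with $\langle D_x+D_y\rangle^{t}f\in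 L^2(\mathbb R^{2n})$, normed by $\|\langle D_x+D_y\rangle^{t}f\|_{L^2}$, where $\langle D_x+D_y\rangle^{t}$ is the Fourier multiplier with symbol $\langle\xi+\eta\rangle^{t}$. (1) There is a constant $k_{n,s}=i\kappa_{n,s}$ with $\kappa_{n,s}>0$, depending only on $n$ and $s$, such that for every $u\in C_c^\infty(\mathbb R^n)$ one has $\mathcal C^*u\in L^2(\mathbb R^{2n})$ and, for almost every $(\xi,\eta)\in\mathbb R^{2n}$, $$\mathcal F(\mathcal C^*u)(\xi,\eta)=k_{n,s}\left(\frac{\xi}{|\xi|^{n/2+1-s}}+\frac{\eta}{|\eta|^{n/2+1-s}}\right)\times\widehat u(\xi+\eta).$$ (2) Let $r\in(0,2s)$. Then $\mathcal C^*$, defined on $C_c^\infty(\mathbb R^n)$, extends uniquely to a bounded linear map $$\mathcal C^*:H^r(\mathbb R^n)\to\langle D_x+D_y\rangle^{r-s}L^2(\mathbb R^{2n}),$$ and if $r\le s$ it also extends uniquely to a bounded linear map $\mathcal C^*:H^r(\mathbb R^n)\to H^{r-s}(\mathbb R^{2n})$. -/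

import Mathlib

open MeasureTheory FourierTransform TemperedDistribution
open scoped SchwartzMap

noncomputable section

/-! ### Vectors and the cross product -/

/-- Physical space `ℝ³`. -/
abbrev R3 : Type := EuclideanSpace ℝ (Fin 3)

/-- The space `ℂ³` of values of the vector fields, with its Hermitian norm. -/
abbrev C3 : Type := EuclideanSpace ℂ (Fin 3)

/-- The two-point space `ℝ³ × ℝ³ = ℝ⁶`, with the Euclidean norm and Lebesgue measure. -/
abbrev R6 : Type := WithLp 2 (R3 × R3)

/-- A real vector, seen as a complex vector. -/
def complexVec (v : R3) : C3 := WithLp.toLp 2 fun i => (v i : ℂ)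

/-- The cross product on `ℂ³` (bilinear over `ℂ`). -/
def cross (a b : C3) : C3 := WithLp.toLp 2 (crossProduct a.ofLp b.ofLp)

/-! ### The adjoint fractional curl on functions -/

/-- The normalization constant `C_{n,s}`, for `n = 3`. -/
def fracConst (s : ℝ) : ℝ :=
  2 ^ s * Real.Gamma ((3 + s) / 2) / (Real.pi ^ ((3 : ℝ) / 2) * |Real.Gamma (-s / 2)|)

/-- The antisymmetric kernel
`α(x, y) = (C_{n,s}^{1/2} / √2) (y - x) / |y - x|^{n/2 + s + 1}`, for `n = 3`. -/
def fracKernel (s : ℝ) (x y : R3) : R3 :=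
  (fracConst s ^ ((1 : ℝ) / 2) / √2 / ‖y - x‖ ^ ((3 : ℝ) / 2 + s + 1)) • (y - x)

/-- The adjoint fractional curl `(C* u)(x, y) = α(x, y) × (u(y) - u(x))`. -/
def fracCurlAdj (s : ℝ) (u : R3 → C3) (p : R6) : C3 :=
  cross (complexVec (fracKernel s p.fst p.snd)) (u p.snd - u p.fst)

/-! ### The Fourier transform with kernel `e^{-i x·ξ}` -/

section Fourier

variable {E F : Type*} [NormedAddCommGroup E] [InnerProductSpace ℝ E] [FiniteDimensional ℝ E]
  [MeasurableSpace E] [BorelSpace E] [NormedAddCommGroup F] [InnerProductSpace ℂ F]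
  [CompleteSpace F]

/-- The Fourier transform `û(ξ) = ∫ e^{-i x·ξ} u(x) dx` of an integrable function. -/
def fourierAngular (u : E → F) (ξ : E) : F :=
  ∫ x, Complex.exp (-Complex.I * (inner ℝ x ξ : ℝ)) • u x

/-- Mathlib's `𝓕` has the kernel `e^{-2πi x·ξ}`. -/
theorem fourierAngular_eq (u : E → F) (ξ : E) :
    fourierAngular u ξ = 𝓕 u ((2 * Real.pi)⁻¹ • ξ) := by
  rw [fourierAngular, Real.fourier_eq']
  congr 1
  ext x
  congr 2
  rw [inner_smul_right]
  have : (Real.pi : ℂ) ≠ 0 := by exact_mod_cast Real.pi_ne_zero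
  push_cast
  field_simp

/-- The Fourier transform with kernel `e^{-i x·ξ}` of a square integrable function (a function
determined up to null sets): Mathlib's `L²` Fourier transform, rescaled. -/
def fourierAngularL2 (g : Lp F 2 (volume : Measure E)) (ξ : E) : F :=
  (𝓕 g : Lp F 2 (volume : Measure E)) ((2 * Real.pi)⁻¹ • ξ)

end Fourier

/-! ### Bessel potential spaces -/

section Bessel

variable {E V : Type*} [NormedAddCommGroup E] [InnerProductSpace ℝ E]
  [NormedAddCommGroup V] [InnerProductSpace ℝ V]

/-- The symbol of `⟨ℓ(D)⟩^r`, namely `ξ ↦ (1 + |ℓ ξ|²)^{r/2}` with `D = -i∂`. The factor `2π` is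
there because Mathlib's Fourier transform has the kernel `e^{-2πi x·ξ}`. -/
def besselSymbol (ℓ : E →L[ℝ] V) (r : ℝ) (ξ : E) : ℂ :=
  ((1 + ‖ℓ ((2 * Real.pi) • ξ)‖ ^ 2) ^ (r / 2) : ℝ)

theorem besselSymbol_temperate (ℓ : E →L[ℝ] V) (r : ℝ) :
    (besselSymbol ℓ r).HasTemperateGrowth := by
  have h := (Function.hasTemperateGrowth_one_add_norm_sq_rpow V (r / 2)).comp
    ((((2 * Real.pi) • ℓ : E →L[ℝ] V)).hasTemperateGrowth)
  have h2 := Complex.ofRealCLM.hasTemperateGrowth.comp h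
  have he : besselSymbol ℓ r = Complex.ofRealCLM ∘
      (fun x : V => (1 + ‖x‖ ^ 2) ^ (r / 2)) ∘ ((2 * Real.pi) • ℓ : E →L[ℝ] V) := by
    funext ξ
    simp [besselSymbol]
  rw [he]
  exact h2

theorem besselSymbol_mul (ℓ : E →L[ℝ] V) (r t : ℝ) :
    besselSymbol ℓ r * besselSymbol ℓ t = besselSymbol ℓ (r + t) := by
  ext ξ
  simp only [besselSymbol, Pi.mul_apply, ← Complex.ofReal_mul]
  rw [← Real.rpow_add (by positivity), add_div]

theorem besselSymbol_zero (ℓ : E →L[ℝ] V) : besselSymbol ℓ 0 = fun _ => 1 := by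
  ext ξ
  simp [besselSymbol]

variable [FiniteDimensional ℝ E] [MeasurableSpace E] [BorelSpace E]
  {F : Type*} [NormedAddCommGroup F] [InnerProductSpace ℂ F] [CompleteSpace F]

variable (F) in
/-- The operator `⟨ℓ(D)⟩^r` on tempered distributions. -/
def besselOp (ℓ : E →L[ℝ] V) (r : ℝ) : 𝓢'(E, F) →L[ℂ] 𝓢'(E, F) :=
  fourierMultiplierCLM F (besselSymbol ℓ r)

theorem besselOp_neg_besselOp (ℓ : E →L[ℝ] V) (r : ℝ) (f : 𝓢'(E, F)) :
    besselOp F ℓ (-r) (besselOp F ℓ r f) = f := by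
  rw [besselOp, besselOp, fourierMultiplierCLM_fourierMultiplierCLM_apply
    (besselSymbol_temperate ℓ r) (besselSymbol_temperate ℓ (-r)), besselSymbol_mul,
    add_neg_cancel, besselSymbol_zero]
  simp

theorem toTemperedDistribution_injective :
    Function.Injective (Lp.toTemperedDistributionCLM F (volume : Measure E) 2).toLinearMap :=
  LinearMap.ker_eq_bot.mp Lp.ker_toTemperedDistributionCLM_eq_bot

variable (F) in
/-- The tempered distributions `f` for which `⟨ℓ(D)⟩^r f` is in `L²`. -/
def besselSubmodule (ℓ : E →L[ℝ] V) (r : ℝ) : Submodule ℂ 𝓢'(E, F) :=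
  (LinearMap.range (Lp.toTemperedDistributionCLM F (volume : Measure E) 2).toLinearMap).comap
    (besselOp F ℓ r).toLinearMap

variable (F) in
/-- The space of tempered distributions `f` for which `⟨ℓ(D)⟩^r f` is in `L²`, to be normed by
`‖⟨ℓ(D)⟩^r f‖_{L²}`. -/
def BesselSpace (ℓ : E →L[ℝ] V) (r : ℝ) : Type _ := besselSubmodule F ℓ r

namespace BesselSpace

variable {ℓ : E →L[ℝ] V} {r : ℝ}

instance : AddCommGroup (BesselSpace F ℓ r) :=
  inferInstanceAs (AddCommGroup (besselSubmodule F ℓ r))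

instance : Module ℂ (BesselSpace F ℓ r) :=
  inferInstanceAs (Module ℂ (besselSubmodule F ℓ r))

/-- The tempered distribution underlying an element. -/
def toDist : BesselSpace F ℓ r →ₗ[ℂ] 𝓢'(E, F) := (besselSubmodule F ℓ r).subtype

/-- The map `f ↦ ⟨ℓ(D)⟩^r f` into `L²`. -/
def toL2 : BesselSpace F ℓ r →ₗ[ℂ] Lp F 2 (volume : Measure E) :=
  (LinearEquiv.ofInjective _ toTemperedDistribution_injective).symm.toLinearMap ∘ₗ
    ((besselOp F ℓ r).toLinearMap.restrict (p := besselSubmodule F ℓ r) fun _ h => h)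

theorem toL2_spec (f : BesselSpace F ℓ r) :
    (toL2 f : 𝓢'(E, F)) = besselOp F ℓ r (toDist f) :=
  congrArg Subtype.val (LinearEquiv.apply_symm_apply
    (LinearEquiv.ofInjective _ (toTemperedDistribution_injective (E := E) (F := F)))
    (((besselOp F ℓ r).toLinearMap.restrict (p := besselSubmodule F ℓ r) fun _ h => h) f))

theorem toDist_injective : Function.Injective (toDist (F := F) (ℓ := ℓ) (r := r)) :=
  Subtype.val_injective

theorem toL2_injective : Function.Injective (toL2 (F := F) (ℓ := ℓ) (r := r)) := by
  intro f g h
  apply toDist_injective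
  rw [← besselOp_neg_besselOp ℓ r (toDist f), ← toL2_spec, h, toL2_spec, besselOp_neg_besselOp]

instance : NormedAddCommGroup (BesselSpace F ℓ r) :=
  NormedAddCommGroup.induced _ _ (toL2 (F := F) (ℓ := ℓ) (r := r)) toL2_injective

instance : NormedSpace ℂ (BesselSpace F ℓ r) :=
  NormedSpace.induced ℂ _ _ (toL2 (F := F) (ℓ := ℓ) (r := r))

theorem norm_eq (f : BesselSpace F ℓ r) : ‖f‖ = ‖toL2 f‖ := rfl

theorem schwartz_mem (ℓ : E →L[ℝ] V) (r : ℝ) (φ : 𝓢(E, F)) :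
    (φ : 𝓢'(E, F)) ∈ besselSubmodule F ℓ r := by
  have h : ((SchwartzMap.fourierMultiplierCLM F (besselSymbol ℓ r) φ).toLp 2 :
      Lp F 2 (volume : Measure E)) = besselOp F ℓ r (φ : 𝓢'(E, F)) := by
    rw [Lp.toTemperedDistribution_toLp_eq, besselOp,
      fourierMultiplierCLM_toTemperedDistributionCLM_eq (besselSymbol_temperate ℓ r)]
  exact ⟨_, h⟩

/-- A Schwartz function, as an element of the space. -/
def ofSchwartz (φ : 𝓢(E, F)) : BesselSpace F ℓ r :=
  ⟨(φ : 𝓢'(E, F)), schwartz_mem ℓ r φ⟩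

theorem toDist_ofSchwartz (φ : 𝓢(E, F)) :
    toDist (ofSchwartz φ : BesselSpace F ℓ r) = (φ : 𝓢'(E, F)) := rfl

end BesselSpace

variable (E F) in
/-- The Sobolev space `H^r`, with the norm `‖⟨D⟩^r f‖_{L²}`. -/
abbrev SobolevH (r : ℝ) : Type _ := BesselSpace F (ContinuousLinearMap.id ℝ E) r

theorem ratio_bound (t c q : ℝ) (hc : 0 < c) (h1 : c ≤ q) (h2 : q ≤ 1) :
    q ^ t ≤ max 1 (c ^ t) := by
  rcases le_total 0 t with h | h
  · exact (Real.rpow_le_one (hc.le.trans h1) h2 h).trans (le_max_left _ _)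
  · exact (Real.rpow_le_rpow_of_nonpos hc h1 h).trans (le_max_right _ _)

/-- As a set, `SobolevH E F r` is Mathlib's Sobolev space of order `r` and exponent `2`. -/
theorem mem_besselSubmodule_id_iff (r : ℝ) (f : 𝓢'(E, F)) :
    f ∈ besselSubmodule F (ContinuousLinearMap.id ℝ E) r ↔ MemSobolev r 2 f := by
  have ha : ∀ t : ℝ, (fun ξ : E => (((1 + ‖ξ‖ ^ 2) ^ (t / 2) : ℝ) : ℂ)).HasTemperateGrowth :=
    fun t => by fun_prop
  have hb := besselSymbol_temperate (ContinuousLinearMap.id ℝ E)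
  have hq : ∀ (t : ℝ) (ξ : E), ‖(besselSymbol (ContinuousLinearMap.id ℝ E) (-t) *
      (fun ξ : E => (((1 + ‖ξ‖ ^ 2) ^ (t / 2) : ℝ) : ℂ))) ξ‖ ≤
      max 1 (((1 / (2 * Real.pi) ^ 2) : ℝ) ^ (t / 2)) := by
    intro t ξ
    have hpi : (1 : ℝ) ≤ (2 * Real.pi) ^ 2 := by nlinarith [Real.pi_gt_three]
    have e : ‖(besselSymbol (ContinuousLinearMap.id ℝ E) (-t) *
        (fun ξ : E => (((1 + ‖ξ‖ ^ 2) ^ (t / 2) : ℝ) : ℂ))) ξ‖ =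
        ((1 + ‖ξ‖ ^ 2) / (1 + ‖(2 * Real.pi) • ξ‖ ^ 2)) ^ (t / 2) := by
      simp only [besselSymbol, Pi.mul_apply, ← Complex.ofReal_mul, Complex.norm_real,
        ContinuousLinearMap.id_apply]
      rw [Real.norm_of_nonneg (by positivity), Real.div_rpow (by positivity) (by positivity),
        neg_div, Real.rpow_neg (by positivity), mul_comm, ← div_eq_mul_inv]
    rw [e]
    have hn : ‖(2 * Real.pi) • ξ‖ ^ 2 = (2 * Real.pi) ^ 2 * ‖ξ‖ ^ 2 := by
      rw [norm_smul, mul_pow, Real.norm_eq_abs, sq_abs]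
    apply ratio_bound _ _ _ (by positivity)
    · rw [hn, div_le_div_iff₀ (by positivity) (by positivity)]
      nlinarith
    · rw [hn, div_le_one (by positivity)]
      nlinarith [sq_nonneg ‖ξ‖]
  have hq' : ∀ (t : ℝ) (ξ : E), ‖((fun ξ : E => (((1 + ‖ξ‖ ^ 2) ^ (-t / 2) : ℝ) : ℂ)) *
      besselSymbol (ContinuousLinearMap.id ℝ E) t) ξ‖ ≤
      max 1 (((1 / (2 * Real.pi) ^ 2) : ℝ) ^ (-t / 2)) := by
    intro t ξ
    have := hq (-t) ξ
    rwa [neg_neg, mul_comm] at this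
  constructor
  · rintro ⟨g, hg⟩
    have h0 : MemSobolev 0 2 (besselOp F (ContinuousLinearMap.id ℝ E) r f) :=
      memSobolev_zero_iff.mpr ⟨g, hg.symm⟩
    have h1 := h0.fourierMultiplierCLM_of_bounded ((hb (-r)).mul (ha r)) ⟨_, hq r⟩
    rw [← fourierMultiplierCLM_fourierMultiplierCLM_apply (hb (-r)) (ha r)] at h1
    change MemSobolev 0 2 (besselPotential E F r (besselOp F _ (-r) _)) at h1
    rw [besselOp_neg_besselOp] at h1
    simpa using h1
  · intro h
    have h0 : MemSobolev 0 2 (besselPotential E F r f) := by simpa using h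
    have h1 := h0.fourierMultiplierCLM_of_bounded ((ha (-r)).mul (hb r)) ⟨_, hq' r⟩
    rw [← fourierMultiplierCLM_fourierMultiplierCLM_apply (ha (-r)) (hb r)] at h1
    change MemSobolev 0 2 (besselOp F _ r (besselPotential E F (-r) (besselPotential E F r f))) at h1
    rw [besselPotential_besselPotential_apply, add_neg_cancel, besselPotential_zero] at h1
    obtain ⟨g, hg⟩ := memSobolev_zero_iff.mp h1
    exact ⟨g, hg.symm⟩

end Bessel

/-- The linear map `(ξ, η) ↦ ξ + η` on `ℝ³ × ℝ³`. -/
def sumMap : R6 →L[ℝ] R3 :=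
  (ContinuousLinearMap.fst ℝ R3 R3 + ContinuousLinearMap.snd ℝ R3 R3).comp
    (WithLp.prodContinuousLinearEquiv 2 ℝ R3 R3 : R6 →L[ℝ] R3 × R3)

theorem sumMap_apply (ζ : R6) : sumMap ζ = ζ.fst + ζ.snd := rfl

/-- The space `⟨D_x + D_y⟩^t L²(ℝ³ × ℝ³)` of two-point fields `f` with
`⟨D_x + D_y⟩^t f ∈ L²`, with the norm `‖⟨D_x + D_y⟩^t f‖_{L²}`. -/
abbrev SumSobolev (t : ℝ) : Type := BesselSpace C3 sumMap t

end

open MeasureTheory FourierTransform TemperedDistribution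
open scoped SchwartzMap

noncomputable section

/-! The `L²` bound is a square function estimate. Since `|α(x, y)|²` is a multiple of `|y -
x|^{-3-2s}`, put `y = x + z` and apply Plancherel in `x`: translation by `z` becomes multiplication
by a character, and `|e^{2πi z·p} - 1|² ≤ min(4, |z|²P²)` with `P = ⟨2πp⟩`. Scaling in `z` gives `∫
|z|^{-3-2s} min(4, |z|²P²) dz = J P^{2s}`, where `J` is finite because `0 < s < 1`. Hence
`‖C*φ‖_{L²} ≤ C ‖φ‖_{H^s}` on Schwartz fields (`exists_eLpNorm_fracCurlAdj_le`).

For the Fourier formula, the kernel `z |z|^{-5/2-s}` is not integrable at infinity, so it is written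
as a superposition of Gaussians, `Γ(β) |z|^{-2β} = ∫ t^{β-1} e^{-t|z|²} dt` with `β = 5/4 + s/2`.
For fixed `t` everything is integrable. The kernel `z e^{-t|z|²}` is a multiple of the gradient of a
Gaussian, so its transform is explicit, and shearing `(x, y)` to `(x, y - x)` factors the transform
of the two-point field. Integrating over `t` again gives a Gamma integral and the homogeneous
symbol. The two exchanges of integrals are made after pairing with a Schwartz function
(`integral_fourier_smul_fracCurlAdj`), and testing identifies the `L²` transform almost everywhere.

In this formula `φ` enters only through `φ̂(ξ + η)`. Thus `C*` intertwines `⟨D⟩^t` with `⟨D_x +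
D_y⟩^t`, and the single bound `H^s → L²` carries over to `H^r → ⟨D_x + D_y⟩^{r-s}L²`. If `r ≤ s`,
the target embeds in `H^{r-s}` because `⟨ξ + η⟩ ≤ √2 ⟨(ξ, η)⟩`. Uniqueness is density of compactly
supported test fields in `H^r`. -/

/-! ### The cross product as a continuous bilinear map -/

/-- The cross product on `ℂ³`, as a continuous bilinear map. -/
def crossCLM : C3 →L[ℂ] C3 →L[ℂ] C3 :=
  LinearMap.toContinuousBilinearMap <|
    LinearMap.mk₂ ℂ cross
      (fun a b c => by simp [cross])
      (fun c a b => by simp [cross])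
      (fun a b c => by simp [cross])
      (fun c a b => by simp [cross])

theorem crossCLM_apply (a b : C3) : crossCLM a b = cross a b := rfl

theorem norm_cross_le (a b : C3) : ‖cross a b‖ ≤ ‖crossCLM‖ * ‖a‖ * ‖b‖ :=
  crossCLM.le_opNorm₂ a b

theorem norm_complexVec (v : R3) : ‖complexVec v‖ = ‖v‖ := by
  simp [complexVec, EuclideanSpace.norm_eq]

/-- The embedding of `ℝ³` into `ℂ³`, as a continuous linear map. -/
def complexVecCLM : R3 →L[ℝ] C3 :=
  LinearMap.mkContinuous
    { toFun := complexVec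
      map_add' := fun a b => by ext i; simp [complexVec]
      map_smul' := fun c a => by ext i; simp [complexVec] } 1
    fun v => by simp [norm_complexVec]

theorem complexVec_smul (c : ℝ) (v : R3) : complexVec (c • v) = c • complexVec v :=
  complexVecCLM.map_smul c v

theorem complexVec_add (v w : R3) : complexVec (v + w) = complexVec v + complexVec w :=
  complexVecCLM.map_add v w

theorem continuous_complexVec : Continuous complexVec := complexVecCLM.continuous

theorem cross_smul_left (c : ℂ) (a b : C3) : cross (c • a) b = c • cross a b := by
  simp [← crossCLM_apply]

theorem cross_smul_right (c : ℂ) (a b : C3) : cross a (c • b) = c • cross a b := by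
  simp [← crossCLM_apply]

theorem cross_real_smul_left (c : ℝ) (a b : C3) : cross (c • a) b = c • cross a b :=
  cross_smul_left (c : ℂ) a b

theorem cross_add_left (a b c : C3) : cross (a + b) c = cross a c + cross b c := by
  simp [← crossCLM_apply]

theorem cross_sub_right (a b c : C3) : cross a (b - c) = cross a b - cross a c := by
  simp [← crossCLM_apply]

theorem cross_neg_left (a b : C3) : cross (-a) b = -cross a b := by
  simp [← crossCLM_apply]

/-! ### Density of compactly supported functions in the Schwartz space -/

section Density

variable {E F : Type*} [NormedAddCommGroup E] [InnerProductSpace ℝ E] [FiniteDimensional ℝ E]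
  [NormedAddCommGroup F] [NormedSpace ℂ F]

/-- The weight `1 + ‖x‖` buys the small factor `ε`. At order zero, `1 - χ(εx)` vanishes unless `ε‖x‖
> 1`; at order `i ≥ 1` the chain rule gives `ε^i ≤ ε`. -/
theorem exists_norm_iteratedFDeriv_one_sub_bump_le (χ : ContDiffBump (0 : E)) (n : ℕ)
    (hχ : 1 ≤ χ.rIn) :
    ∃ C : ℝ, 0 ≤ C ∧ ∀ ε : ℝ, 0 < ε → ε ≤ 1 → ∀ i ≤ n, ∀ x : E,
      ‖iteratedFDeriv ℝ i (fun x => 1 - χ (ε • x)) x‖ ≤ C * ε * (1 + ‖x‖) := by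
  have hb : ∀ i : ℕ, ∃ C : ℝ, ∀ x : E, ‖iteratedFDeriv ℝ i χ x‖ ≤ C := fun i =>
    (χ.contDiff (n := i).continuous_iteratedFDeriv le_rfl).bounded_above_of_compact_support
      (χ.hasCompactSupport.iteratedFDeriv i)
  choose B hB using hb
  have hB0 : ∀ i, 0 ≤ B i := fun i => (norm_nonneg _).trans (hB i 0)
  refine ⟨1 + ∑ i ∈ Finset.range (n + 1), B i, by
    have := Finset.sum_nonneg fun i (_ : i ∈ Finset.range (n + 1)) => hB0 i
    positivity, fun ε hε hε1 i hi x => ?_⟩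
  have hS : B i ≤ ∑ i ∈ Finset.range (n + 1), B i :=
    Finset.single_le_sum (fun j _ => hB0 j) (Finset.mem_range.mpr (by omega))
  have hS0 : 0 ≤ ∑ i ∈ Finset.range (n + 1), B i := (hB0 i).trans hS
  rcases Nat.eq_zero_or_pos i with rfl | hipos
  · rw [norm_iteratedFDeriv_zero]
    have h1 : ‖1 - χ (ε • x)‖ ≤ ε * ‖x‖ := by
      rw [Real.norm_of_nonneg (by linarith [χ.le_one (x := ε • x)])]
      by_cases h : ε • x ∈ Metric.closedBall (0 : E) χ.rIn
      · rw [χ.one_of_mem_closedBall h]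
        simp; positivity
      · have h2 : 1 < ε * ‖x‖ := by
          rw [mem_closedBall_zero_iff, norm_smul, Real.norm_of_nonneg hε.le] at h
          linarith
        linarith [χ.nonneg (x := ε • x)]
    refine h1.trans ?_
    have : 0 ≤ ε * ‖x‖ := by positivity
    nlinarith [mul_nonneg (mul_nonneg hS0 hε.le) (by positivity : 0 ≤ 1 + ‖x‖)]
  · have hc : ContDiff ℝ i (fun x : E => χ (ε • x)) :=
      χ.contDiff.comp (contDiff_const_smul ε)
    have h1 : iteratedFDeriv ℝ i (fun x : E => 1 - χ (ε • x)) x =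
        -(ε ^ i • iteratedFDeriv ℝ i χ (ε • x)) := by
      have := iteratedFDeriv_sub_apply (𝕜 := ℝ) (i := i) (x := x) (f := fun _ : E => (1 : ℝ))
        (g := fun x => χ (ε • x)) contDiff_const.contDiffAt hc.contDiffAt
      change iteratedFDeriv ℝ i ((fun _ : E => (1 : ℝ)) - fun x => χ (ε • x)) x = _
      rw [this, iteratedFDeriv_const_of_ne hipos.ne', iteratedFDeriv_comp_const_smul ε χ.contDiff]
      simp
    rw [h1, norm_neg, norm_smul, norm_pow, Real.norm_of_nonneg hε.le]
    have h2 : ε ^ i ≤ ε := by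
      simpa using pow_le_pow_of_le_one hε.le hε1 hipos
    calc ε ^ i * ‖iteratedFDeriv ℝ i χ (ε • x)‖ ≤ ε * B i := by gcongr; exact hB i _
      _ ≤ ε * (1 + ∑ i ∈ Finset.range (n + 1), B i) * 1 := by
          rw [mul_one]; gcongr; linarith
      _ ≤ _ := by
          rw [mul_comm ε]
          gcongr
          linarith [norm_nonneg x]

theorem dense_hasCompactSupport_schwartzMap :
    Dense {φ : 𝓢(E, F) | HasCompactSupport φ} := by
  intro φ
  let χ : ContDiffBump (0 : E) := ⟨1, 2, one_pos, one_lt_two⟩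
  let ε : ℕ → ℝ := fun m => 1 / ((m : ℝ) + 1)
  have hε : ∀ m, 0 < ε m := fun m => by positivity
  have hε1 : ∀ m, ε m ≤ 1 := fun m => by
    rw [div_le_one (by positivity)]; linarith [Nat.cast_nonneg (α := ℝ) m]
  have hsm : ∀ m, ContDiff ℝ (⊤ : ℕ∞) fun x : E => χ (ε m • x) := fun m =>
    χ.contDiff.comp (contDiff_const_smul (ε m))
  have hcs : ∀ m, HasCompactSupport fun x : E => χ (ε m • x) • φ x := fun m =>
    (χ.hasCompactSupport.comp_smul (hε m).ne').smul_right
  let ψ : ℕ → 𝓢(E, F) := fun m => (hcs m).toSchwartzMap ((hsm m).smul (φ.smooth ⊤))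
  refine mem_closure_of_tendsto (f := ψ) (b := Filter.atTop) ?_
    (Filter.Eventually.of_forall fun m => hcs m)
  rw [(schwartz_withSeminorms ℝ E F).tendsto_nhds]
  rintro ⟨k, n⟩ δ hδ
  obtain ⟨C, hC0, hC⟩ := exists_norm_iteratedFDeriv_one_sub_bump_le χ n le_rfl
  -- Leibniz rule with the cutoff estimate: the factor `1 + ‖x‖` costs one more power of `‖x‖`,
  -- hence the seminorms of weight `k + 1`.
  let D : ℝ := ∑ i ∈ Finset.range (n + 1), (n.choose i : ℝ) * C *
    (SchwartzMap.seminorm ℝ k (n - i) φ + SchwartzMap.seminorm ℝ (k + 1) (n - i) φ)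
  have hD : ∀ m, SchwartzMap.seminorm ℝ k n (ψ m - φ) ≤ ε m * D := by
    intro m
    have hD0 : 0 ≤ D := Finset.sum_nonneg fun i _ => by positivity
    refine SchwartzMap.seminorm_le_bound ℝ k n _ (mul_nonneg (hε m).le hD0) fun x => ?_
    have h1 : (⇑(ψ m - φ) : E → F) = -fun x => (1 - χ (ε m • x)) • φ x := by
      ext x
      change χ (ε m • x) • φ x - φ x = -((1 - χ (ε m • x)) • φ x)
      rw [sub_smul, one_smul]; abel
    rw [h1, iteratedFDeriv_neg_apply, norm_neg]
    have h2 := norm_iteratedFDeriv_smul_le (n := n) (N := (⊤ : ℕ∞)) (contDiff_const.sub (hsm m) :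
      ContDiff ℝ (⊤ : ℕ∞) fun x : E => 1 - χ (ε m • x)) (φ.smooth ⊤) x (mod_cast le_top)
    calc _ ≤ ‖x‖ ^ k * _ := mul_le_mul_of_nonneg_left h2 (by positivity)
      _ ≤ ε m * D := by
        rw [Finset.mul_sum, Finset.mul_sum]
        refine Finset.sum_le_sum fun i hi => ?_
        have h3 := hC (ε m) (hε m) (hε1 m) i (by have := Finset.mem_range.mp hi; omega) x
        have h4 := φ.le_seminorm ℝ k (n - i) x
        have h5 := φ.le_seminorm ℝ (k + 1) (n - i) x
        calc _ ≤ ‖x‖ ^ k * ((n.choose i : ℝ) * (C * ε m * (1 + ‖x‖)) *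
              ‖iteratedFDeriv ℝ (n - i) φ x‖) := by gcongr
          _ = ε m * ((n.choose i : ℝ) * C * (‖x‖ ^ k * ‖iteratedFDeriv ℝ (n - i) φ x‖ +
              ‖x‖ ^ (k + 1) * ‖iteratedFDeriv ℝ (n - i) φ x‖)) := by ring
          _ ≤ _ := by
            have := hε m
            gcongr
  have ht : Filter.Tendsto (fun m => ε m * D) Filter.atTop (nhds 0) := by
    simpa only [zero_mul] using tendsto_one_div_add_atTop_nhds_zero_nat.mul_const D
  filter_upwards [ht.eventually_lt_const hδ] with m hm
  exact (hD m).trans_lt hm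

end Density

/-! ### Isometry with `L²`, and bounded multipliers -/

section Isometry

variable {E V : Type*} [NormedAddCommGroup E] [InnerProductSpace ℝ E]
  [NormedAddCommGroup V] [InnerProductSpace ℝ V]
  [FiniteDimensional ℝ E] [MeasurableSpace E] [BorelSpace E]
  {F : Type*} [NormedAddCommGroup F] [InnerProductSpace ℂ F] [CompleteSpace F]

theorem Lp_toTemperedDistribution_injective {f g : Lp F 2 (volume : Measure E)}
    (h : (f : 𝓢'(E, F)) = g) : f = g :=
  toTemperedDistribution_injective h

/-- By Plancherel the operator is multiplication by an `L^∞` function conjugated by the Fourier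
transform of `L²`; temperate growth makes it agree with the multiplier on distributions. -/
theorem exists_continuousLinearMap_fourierMultiplier {q : E → ℂ} (hq : q.HasTemperateGrowth)
    {C : ℝ} (hC : ∀ x, ‖q x‖ ≤ C) :
    ∃ M : Lp F 2 (volume : Measure E) →L[ℂ] Lp F 2 (volume : Measure E),
      ∀ f : Lp F 2 (volume : Measure E), (M f : 𝓢'(E, F)) = fourierMultiplierCLM F q f := by
  let g : BoundedContinuousFunction E ℂ :=
    BoundedContinuousFunction.ofNormedAddCommGroup q hq.1.continuous C hC
  let G : Lp ℂ ⊤ (volume : Measure E) := g.memLp_top.toLp _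
  let S : Lp F 2 (volume : Measure E) →L[ℂ] Lp F 2 (volume : Measure E) :=
    LinearMap.mkContinuous
      { toFun := fun f => G • f
        map_add' := fun f f' => Lp.add_smul _ _ _
        map_smul' := fun c f => (Lp.smul_comm c G f).symm } ‖G‖ fun f => Lp.norm_smul_le G f
  refine ⟨fourierInvCLM ℂ _ ∘L S ∘L fourierCLM ℂ _, fun f => ?_⟩
  change Lp.toTemperedDistribution (𝓕⁻ (G • 𝓕 f : Lp F 2 (volume : Measure E))) = _
  rw [← Lp.fourierInv_toTemperedDistribution_eq, Lp.toTemperedDistribution_smul_eq (by exact hq),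
    ← Lp.fourier_toTemperedDistribution_eq, fourierMultiplierCLM_apply]
  rfl

namespace BesselSpace

variable {ℓ : E →L[ℝ] V} {r : ℝ}

theorem besselOp_besselOp_neg (f : 𝓢'(E, F)) :
    besselOp F ℓ r (besselOp F ℓ (-r) f) = f := by
  simpa using besselOp_neg_besselOp ℓ (-r) f

theorem toL2_eq_of_besselOp_eq {f : BesselSpace F ℓ r} {g : Lp F 2 (volume : Measure E)}
    (h : besselOp F ℓ r (toDist f) = g) : toL2 f = g :=
  Lp_toTemperedDistribution_injective (by rw [toL2_spec, h])

theorem toL2_surjective : Function.Surjective (toL2 (F := F) (ℓ := ℓ) (r := r)) := by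
  intro g
  have h := besselOp_besselOp_neg (ℓ := ℓ) (r := r) (g : 𝓢'(E, F))
  exact ⟨⟨besselOp F ℓ (-r) g, ⟨g, h.symm⟩⟩, toL2_eq_of_besselOp_eq h⟩

variable (F ℓ r) in
/-- The isometry `f ↦ ⟨ℓ(D)⟩^r f` onto `L²`. -/
def toL2Equiv : BesselSpace F ℓ r ≃ₗᵢ[ℂ] Lp F 2 (volume : Measure E) :=
  LinearIsometryEquiv.mk (LinearEquiv.ofBijective toL2 ⟨toL2_injective, toL2_surjective⟩)
    fun f => (norm_eq f).symm

theorem toDist_toL2Equiv_symm (g : Lp F 2 (volume : Measure E)) :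
    toDist ((toL2Equiv F ℓ r).symm g) = besselOp F ℓ (-r) g := by
  have h : toL2 ((toL2Equiv F ℓ r).symm g) = g := (toL2Equiv F ℓ r).apply_symm_apply g
  conv_rhs => rw [← h, toL2_spec, besselOp_neg_besselOp]

theorem toL2_ofSchwartz (φ : 𝓢(E, F)) :
    toL2 (ofSchwartz φ : BesselSpace F ℓ r) =
      (SchwartzMap.fourierMultiplierCLM F (besselSymbol ℓ r) φ).toLp 2 := by
  apply toL2_eq_of_besselOp_eq
  rw [Lp.toTemperedDistribution_toLp_eq, toDist_ofSchwartz, besselOp,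
    fourierMultiplierCLM_toTemperedDistributionCLM_eq (besselSymbol_temperate ℓ r)]

theorem toL2Equiv_symm_toLp (φ : 𝓢(E, F)) :
    (toL2Equiv F ℓ r).symm ((SchwartzMap.fourierMultiplierCLM F (besselSymbol ℓ r) φ).toLp 2) =
      ofSchwartz φ := by
  rw [← toL2_ofSchwartz]
  exact (toL2Equiv F ℓ r).symm_apply_apply _

theorem fourierMultiplierCLM_besselSymbol_neg (φ : 𝓢(E, F)) :
    SchwartzMap.fourierMultiplierCLM F (besselSymbol ℓ r)
      (SchwartzMap.fourierMultiplierCLM F (besselSymbol ℓ (-r)) φ) = φ := by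
  rw [SchwartzMap.fourierMultiplierCLM_fourierMultiplierCLM_apply (besselSymbol_temperate ℓ r)
    (besselSymbol_temperate ℓ (-r)), besselSymbol_mul, add_neg_cancel, besselSymbol_zero]
  simp

theorem continuous_ofSchwartz :
    Continuous (ofSchwartz : 𝓢(E, F) → BesselSpace F ℓ r) := by
  have h : (ofSchwartz : 𝓢(E, F) → BesselSpace F ℓ r) = fun φ => (toL2Equiv F ℓ r).symm
      ((SchwartzMap.fourierMultiplierCLM F (besselSymbol ℓ r) φ).toLp 2) := by
    ext1 φ
    rw [toL2Equiv_symm_toLp]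
  rw [h]
  exact (toL2Equiv F ℓ r).symm.continuous.comp
    (SchwartzMap.continuous_toLp.comp (ContinuousLinearMap.continuous _))

/-- Schwartz functions are dense in `L²`, and `⟨ℓ(D)⟩^{-r}` maps Schwartz functions to Schwartz
functions. -/
theorem denseRange_ofSchwartz :
    DenseRange (ofSchwartz : 𝓢(E, F) → BesselSpace F ℓ r) := by
  have h : Dense (Set.range fun φ : 𝓢(E, F) => (toL2Equiv F ℓ r).symm (φ.toLp 2)) :=
    (toL2Equiv F ℓ r).symm.surjective.denseRange.comp
      (SchwartzMap.denseRange_toLpCLM (p := 2) ENNReal.ofNat_ne_top)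
      (toL2Equiv F ℓ r).symm.continuous
  refine h.mono ?_
  rintro _ ⟨φ, rfl⟩
  refine ⟨SchwartzMap.fourierMultiplierCLM F (besselSymbol ℓ (-r)) φ, ?_⟩
  rw [← toL2Equiv_symm_toLp, fourierMultiplierCLM_besselSymbol_neg]

theorem dense_ofSchwartz_hasCompactSupport :
    Dense ((ofSchwartz : 𝓢(E, F) → BesselSpace F ℓ r) '' {φ | HasCompactSupport φ}) :=
  denseRange_ofSchwartz.dense_image continuous_ofSchwartz dense_hasCompactSupport_schwartzMap

/-- In the `L²` pictures of the two spaces, the identity of distributions is the multiplier by the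
quotient of the symbols. -/
theorem exists_inclusion {V' : Type*} [NormedAddCommGroup V'] [InnerProductSpace ℝ V']
    {ℓ' : E →L[ℝ] V'} {t C : ℝ}
    (hC : ∀ ξ, ‖besselSymbol ℓ (-t) ξ * besselSymbol ℓ' t ξ‖ ≤ C) :
    ∃ J : BesselSpace F ℓ t →L[ℂ] BesselSpace F ℓ' t, ∀ f, toDist (J f) = toDist f := by
  obtain ⟨M, hM⟩ := exists_continuousLinearMap_fourierMultiplier (F := F)
    ((besselSymbol_temperate ℓ (-t)).mul (besselSymbol_temperate ℓ' t)) hC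
  refine ⟨((toL2Equiv F ℓ' t).symm : Lp F 2 (volume : Measure E) →L[ℂ] BesselSpace F ℓ' t) ∘L M ∘L
    (toL2Equiv F ℓ t : BesselSpace F ℓ t →L[ℂ] Lp F 2 (volume : Measure E)), fun f => ?_⟩
  change toDist ((toL2Equiv F ℓ' t).symm (M (toL2 f))) = toDist f
  rw [toDist_toL2Equiv_symm, hM, toL2_spec,
    ← fourierMultiplierCLM_fourierMultiplierCLM_apply (besselSymbol_temperate ℓ (-t))
      (besselSymbol_temperate ℓ' t)]
  change besselOp F ℓ' (-t) (besselOp F ℓ' t (besselOp F ℓ (-t) (besselOp F ℓ t (toDist f)))) = _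
  rw [besselOp_neg_besselOp, besselOp_neg_besselOp]

end BesselSpace

end Isometry

/-! ### Integrals over `ℝ³` and `ℝ³ × ℝ³` -/

/-- Polar coordinates: the Jacobian `y²` shifts both exponents by `2`, so `-3` is the threshold at
the origin and at infinity. -/
theorem integrable_comp_norm_of_rpow_bounds {f : ℝ → ℝ} (hf : Measurable f) {C a b : ℝ}
    (ha : -3 < a) (hb : b < -3) (h0 : ∀ y, 0 < y → y ≤ 1 → |f y| ≤ C * y ^ a)
    (h1 : ∀ y, 1 < y → |f y| ≤ C * y ^ b) : Integrable fun z : R3 => f ‖z‖ := by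
  rw [integrable_fun_norm_addHaar (volume : Measure R3), finrank_euclideanSpace_fin,
    ← Set.Ioc_union_Ioi_eq_Ioi zero_le_one]
  have hm : Measurable fun y : ℝ => y ^ (3 - 1) • f y := by fun_prop
  refine IntegrableOn.union ?_ ?_
  · have hi : IntegrableOn (fun y : ℝ => C * y ^ (a + 2)) (Set.Ioc 0 1) :=
      ((intervalIntegrable_iff_integrableOn_Ioc_of_le zero_le_one).mp
        (intervalIntegral.intervalIntegrable_rpow' (by linarith))).const_mul C
    refine hi.mono' hm.aestronglyMeasurable
      ((ae_restrict_iff' measurableSet_Ioc).mpr (Filter.Eventually.of_forall fun y hy => ?_))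
    rw [norm_smul, Real.norm_eq_abs (f y), Real.rpow_add hy.1, norm_pow,
      Real.norm_of_nonneg hy.1.le, Real.rpow_two]
    have := mul_le_mul_of_nonneg_left (h0 y hy.1 hy.2) (sq_nonneg y)
    norm_num
    linarith
  · have hi : IntegrableOn (fun y : ℝ => C * y ^ (b + 2)) (Set.Ioi 1) :=
      (integrableOn_Ioi_rpow_of_lt (by linarith) one_pos).const_mul C
    refine hi.mono' hm.aestronglyMeasurable
      ((ae_restrict_iff' measurableSet_Ioi).mpr (Filter.Eventually.of_forall fun y hy => ?_))
    have hy0 : 0 < y := one_pos.trans hy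
    rw [norm_smul, Real.norm_eq_abs (f y), Real.rpow_add hy0, norm_pow,
      Real.norm_of_nonneg hy0.le, Real.rpow_two]
    have := mul_le_mul_of_nonneg_left (h1 y hy) (sq_nonneg y)
    norm_num
    linarith

theorem lintegral_R6_eq {f : R3 × R3 → ENNReal} (hf : Measurable f) :
    ∫⁻ p : R6, f (p.fst, p.snd) = ∫⁻ z : R3, ∫⁻ x : R3, f (x, x + z) := by
  have h1 : ∫⁻ p : R6, f (p.fst, p.snd) = ∫⁻ q, f q :=
    (WithLp.volume_preserving_ofLp R3 R3).lintegral_comp hf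
  rw [h1, Measure.volume_eq_prod, lintegral_prod _ hf.aemeasurable,
    lintegral_lintegral_swap (f := fun z x : R3 => f (x, x + z)) (by fun_prop)]
  congr with x
  exact (lintegral_add_left_eq_self (μ := (volume : Measure R3)) (fun y => f (x, y)) x).symm

theorem lintegral_enorm_sq_fourier (ψ : 𝓢(R3, C3)) :
    ∫⁻ p, ‖(𝓕 ψ) p‖ₑ ^ 2 = ∫⁻ x, ‖ψ x‖ₑ ^ 2 := by
  have h : ∀ θ : 𝓢(R3, C3), ∫⁻ x, ‖θ x‖ₑ ^ 2 = ENNReal.ofReal (∫ x, ‖θ x‖ ^ 2) := fun θ => by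
    rw [ofReal_integral_eq_lintegral_ofReal ((θ.memLp 2 volume).integrable_norm_pow (by simp))
      (Filter.Eventually.of_forall fun x => by positivity)]
    simp [ENNReal.ofReal_pow, ofReal_norm]
  rw [h, h, SchwartzMap.integral_norm_sq_fourier]

/-! ### The square function of differences -/

theorem fourier_translate_sub (φ : 𝓢(R3, C3)) (z p : R3) :
    (𝓕 (SchwartzMap.compSubConstCLM ℂ (-z) φ - φ)) p =
      (Real.fourierChar (inner ℝ z p) - 1 : ℂ) • (𝓕 φ) p := by
  have h1 : (𝓕 (SchwartzMap.compSubConstCLM ℂ (-z) φ)) p =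
      (Real.fourierChar (inner ℝ z p) : ℂ) • (𝓕 φ) p := by
    have := congrFun (VectorFourier.fourierIntegral_comp_add_right Real.fourierChar
      (volume : Measure R3) (innerₗ R3) φ z) p
    have h2 : (⇑(SchwartzMap.compSubConstCLM ℂ (-z) φ) : R3 → C3) = φ ∘ fun v => v + z := by
      ext1 v
      simp
    rw [SchwartzMap.fourier_coe, h2]
    exact this
  have h3 : 𝓕 (SchwartzMap.compSubConstCLM ℂ (-z) φ - φ) =
      𝓕 (SchwartzMap.compSubConstCLM ℂ (-z) φ) - 𝓕 φ :=
    map_sub (fourierCLM ℂ 𝓢(R3, C3)) _ _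
  rw [h3, sub_smul, one_smul, ← h1]
  rfl

theorem norm_fourierChar_sub_one_sq_le (z p : R3) :
    ‖(Real.fourierChar (inner ℝ z p) - 1 : ℂ)‖ ^ 2 ≤
      min 4 ((‖z‖ * √(1 + ‖(2 * Real.pi) • p‖ ^ 2)) ^ 2) := by
  refine le_min ?_ ?_
  · have h : ‖(Real.fourierChar (inner ℝ z p) - 1 : ℂ)‖ ≤ 2 :=
      (norm_sub_le _ _).trans (by rw [Circle.norm_coe, norm_one]; norm_num)
    nlinarith [norm_nonneg (Real.fourierChar (inner ℝ z p) - 1 : ℂ)]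
  · have h : ‖(Real.fourierChar (inner ℝ z p) - 1 : ℂ)‖ ≤ ‖2 * Real.pi * inner ℝ z p‖ := by
      rw [Real.fourierChar_apply, mul_comm _ Complex.I]
      exact Real.norm_exp_I_mul_ofReal_sub_one_le
    have h2 : ‖2 * Real.pi * inner ℝ z p‖ ≤ ‖z‖ * ‖(2 * Real.pi) • p‖ := by
      rw [← inner_smul_right]
      exact norm_inner_le_norm z _
    -- Replacing `|2πp|` by `⟨2πp⟩` keeps the scale positive, and its power `2s` is the square of
    -- the Bessel symbol of order `s`.
    have h3 : ‖(2 * Real.pi) • p‖ ≤ √(1 + ‖(2 * Real.pi) • p‖ ^ 2) :=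
      Real.le_sqrt_of_sq_le (by linarith)
    exact pow_le_pow_left₀ (norm_nonneg _) ((h.trans h2).trans (by gcongr)) 2

/-- Plancherel in `x` for fixed `z`. -/
theorem lintegral_translate_sub_le (φ : 𝓢(R3, C3)) (z : R3) :
    ∫⁻ x, ‖φ (x + z) - φ x‖ₑ ^ 2 ≤
      ∫⁻ p, ENNReal.ofReal (min 4 ((‖z‖ * √(1 + ‖(2 * Real.pi) • p‖ ^ 2)) ^ 2)) *
        ‖(𝓕 φ) p‖ₑ ^ 2 := by
  have h := lintegral_enorm_sq_fourier (SchwartzMap.compSubConstCLM ℂ (-z) φ - φ)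
  have h1 : ∀ x, (SchwartzMap.compSubConstCLM ℂ (-z) φ - φ) x = φ (x + z) - φ x := fun x => by
    simp
  simp_rw [h1] at h
  rw [← h]
  refine lintegral_mono fun p => ?_
  rw [fourier_translate_sub, enorm_smul, mul_pow]
  gcongr
  rw [← ofReal_norm, ← ENNReal.ofReal_pow (norm_nonneg _)]
  exact ENNReal.ofReal_le_ofReal (norm_fourierChar_sub_one_sq_le z p)

/-- Substitution `z ↦ Pz`: homogeneity contributes `P^{3+2s}` and the Jacobian `P^{-3}`. -/
theorem lintegral_rpow_mul_min_scale (s : ℝ) {P : ℝ} (hP : 0 < P) :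
    ∫⁻ z : R3, ENNReal.ofReal (‖z‖ ^ (-(3 + 2 * s)) * min 4 ((‖z‖ * P) ^ 2)) =
      ENNReal.ofReal (P ^ (2 * s)) *
        ∫⁻ z : R3, ENNReal.ofReal (‖z‖ ^ (-(3 + 2 * s)) * min 4 (‖z‖ ^ 2)) := by
  have hm : Measurable fun z : R3 => ENNReal.ofReal (‖z‖ ^ (-(3 + 2 * s)) * min 4 (‖z‖ ^ 2)) := by
    fun_prop
  have h : ∫⁻ z : R3, ENNReal.ofReal (‖P • z‖ ^ (-(3 + 2 * s)) * min 4 (‖P • z‖ ^ 2)) =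
      ENNReal.ofReal ((P ^ 3)⁻¹) *
        ∫⁻ z : R3, ENNReal.ofReal (‖z‖ ^ (-(3 + 2 * s)) * min 4 (‖z‖ ^ 2)) := by
    rw [← lintegral_map (μ := (volume : Measure R3)) (g := fun z : R3 => P • z) hm
      (measurable_const_smul P), Measure.map_addHaar_smul volume hP.ne', lintegral_smul_measure,
      finrank_euclideanSpace_fin, abs_of_pos (by positivity), smul_eq_mul]
  have h2 : ∀ z : R3, ENNReal.ofReal (‖z‖ ^ (-(3 + 2 * s)) * min 4 ((‖z‖ * P) ^ 2)) =
      ENNReal.ofReal (P ^ (3 + 2 * s)) *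
        ENNReal.ofReal (‖P • z‖ ^ (-(3 + 2 * s)) * min 4 (‖P • z‖ ^ 2)) := fun z => by
    rw [← ENNReal.ofReal_mul (by positivity), norm_smul, Real.norm_of_nonneg hP.le,
      Real.mul_rpow hP.le (norm_nonneg z), Real.rpow_neg hP.le, mul_comm P]
    congr 1
    field_simp
  simp_rw [h2]
  rw [lintegral_const_mul _ (by fun_prop), h, ← mul_assoc,
    ← ENNReal.ofReal_mul (by positivity), Real.rpow_add hP]
  congr 2
  norm_cast
  field_simp

/-- Near the origin the integrand is at most `|z|^{-1-2s}`, integrable since `s < 1`; at infinity it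
is at most `4|z|^{-3-2s}`, integrable since `s > 0`. -/
theorem lintegral_rpow_mul_min_lt_top {s : ℝ} (hs : s ∈ Set.Ioo (0 : ℝ) 1) :
    ∫⁻ z : R3, ENNReal.ofReal (‖z‖ ^ (-(3 + 2 * s)) * min 4 (‖z‖ ^ 2)) < ⊤ := by
  have h : Integrable fun z : R3 => ‖z‖ ^ (-(3 + 2 * s)) * min 4 (‖z‖ ^ 2) := by
    refine integrable_comp_norm_of_rpow_bounds
      (f := fun y => y ^ (-(3 + 2 * s)) * min 4 (y ^ 2)) (by fun_prop) (C := 4)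
      (a := -(1 + 2 * s)) (b := -(3 + 2 * s)) (by linarith [hs.2]) (by linarith [hs.1]) ?_ ?_
    · intro y hy _
      rw [abs_of_nonneg (by positivity),
        show -(1 + 2 * s) = -(3 + 2 * s) + 2 by ring, Real.rpow_add hy, Real.rpow_two]
      have h1 : (0 : ℝ) < y ^ (-(3 + 2 * s)) := by positivity
      nlinarith [min_le_right 4 (y ^ 2), mul_nonneg h1.le (sq_nonneg y)]
    · intro y hy
      have : 0 < y := one_pos.trans hy
      rw [abs_of_nonneg (by positivity), mul_comm]
      gcongr
      exact min_le_left _ _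
  exact h.lintegral_lt_top


/-! ### The `L²` bound of the adjoint fractional curl by the `H^s` norm -/

theorem fracConst_pos {s : ℝ} (hs : s ∈ Set.Ioo (0 : ℝ) 1) : 0 < fracConst s := by
  have h1 : Real.Gamma (-s / 2) ≠ 0 := by
    refine Real.Gamma_ne_zero fun m h => ?_
    rcases Nat.eq_zero_or_pos m with rfl | hm
    · norm_num at h
      linarith [hs.1]
    · have : (1 : ℝ) ≤ m := by exact_mod_cast hm
      linarith [hs.2]
  have h2 : 0 < Real.Gamma ((3 + s) / 2) := Real.Gamma_pos_of_pos (by linarith [hs.1])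
  have := Real.pi_pos
  unfold fracConst
  positivity

/-- The numerical factor of the kernel. -/
def kernelFactor (s : ℝ) : ℝ := fracConst s ^ ((1 : ℝ) / 2) / √2

theorem kernelFactor_pos {s : ℝ} (hs : s ∈ Set.Ioo (0 : ℝ) 1) : 0 < kernelFactor s := by
  have := fracConst_pos hs
  unfold kernelFactor
  positivity

theorem norm_fracKernel_sq_le {s : ℝ} (hs : s ∈ Set.Ioo (0 : ℝ) 1) (x y : R3) :
    ‖fracKernel s x y‖ ^ 2 ≤ kernelFactor s ^ 2 * ‖y - x‖ ^ (-(3 + 2 * s)) := by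
  have h := kernelFactor_pos hs
  have he : fracKernel s x y =
      (kernelFactor s / ‖y - x‖ ^ ((3 : ℝ) / 2 + s + 1)) • (y - x) := rfl
  rw [he, norm_smul, Real.norm_of_nonneg (by positivity)]
  rcases (norm_nonneg (y - x)).eq_or_lt with h0 | h0
  · rw [← h0]
    have : (0 : ℝ) ≤ 0 ^ (-(3 + 2 * s)) := Real.rpow_nonneg le_rfl _
    rw [mul_zero, zero_pow two_ne_zero]
    positivity
  · have h1 : ‖y - x‖ ^ (3 + 2 * s) * ‖y - x‖ ^ 2 = (‖y - x‖ ^ ((3 : ℝ) / 2 + s + 1)) ^ 2 := by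
      rw [← Real.rpow_two (_ ^ _), ← Real.rpow_mul h0.le, ← Real.rpow_two, ← Real.rpow_add h0]
      ring_nf
    rw [mul_pow, div_pow, ← h1, Real.rpow_neg h0.le]
    apply le_of_eq
    field_simp

theorem measurable_cross {α : Type*} [MeasurableSpace α] {f g : α → C3} (hf : Measurable f)
    (hg : Measurable g) : Measurable fun x => cross (f x) (g x) := by
  have h : Continuous fun q : C3 × C3 => cross q.1 q.2 := by
    simp only [← crossCLM_apply]
    exact crossCLM.continuous₂
  exact h.measurable2 hf hg

theorem measurable_fracCurlAdj (s : ℝ) (φ : 𝓢(R3, C3)) : Measurable (fracCurlAdj s φ) := by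
  have h1 : Measurable fun p : R6 => complexVec (fracKernel s p.fst p.snd) := by
    refine continuous_complexVec.measurable.comp ?_
    unfold fracKernel
    fun_prop
  have h2 : Measurable fun p : R6 => φ p.snd - φ p.fst :=
    (φ.continuous.measurable.comp (by fun_prop)).sub (φ.continuous.measurable.comp (by fun_prop))
  exact measurable_cross h1 h2

theorem enorm_fracCurlAdj_sq_le {s : ℝ} (hs : s ∈ Set.Ioo (0 : ℝ) 1) (φ : R3 → C3) (p : R6) :
    ‖fracCurlAdj s φ p‖ₑ ^ 2 ≤ ENNReal.ofReal ((‖crossCLM‖ * kernelFactor s) ^ 2) *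
      (ENNReal.ofReal (‖p.snd - p.fst‖ ^ (-(3 + 2 * s))) * ‖φ p.snd - φ p.fst‖ₑ ^ 2) := by
  simp_rw [← ofReal_norm]
  rw [← ENNReal.ofReal_pow (norm_nonneg _), ← ENNReal.ofReal_pow (norm_nonneg _),
    ← ENNReal.ofReal_mul (by positivity), ← ENNReal.ofReal_mul (by positivity)]
  refine ENNReal.ofReal_le_ofReal ?_
  calc ‖fracCurlAdj s φ p‖ ^ 2
      ≤ (‖crossCLM‖ * ‖complexVec (fracKernel s p.fst p.snd)‖ * ‖φ p.snd - φ p.fst‖) ^ 2 :=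
        pow_le_pow_left₀ (norm_nonneg _) (norm_cross_le _ _) 2
    _ = ‖crossCLM‖ ^ 2 * ‖fracKernel s p.fst p.snd‖ ^ 2 * ‖φ p.snd - φ p.fst‖ ^ 2 := by
        rw [norm_complexVec]; ring
    _ ≤ ‖crossCLM‖ ^ 2 * (kernelFactor s ^ 2 * ‖p.snd - p.fst‖ ^ (-(3 + 2 * s))) *
          ‖φ p.snd - φ p.fst‖ ^ 2 := by
        gcongr
        exact norm_fracKernel_sq_le hs _ _
    _ = _ := by ring

/-- Tonelli twice: first in `(x, z)` to use Plancherel for each `z`, then in `(z, p)` to integrate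
out `z` by scaling. -/
theorem lintegral_enorm_fracCurlAdj_sq_le {s : ℝ} (hs : s ∈ Set.Ioo (0 : ℝ) 1) (φ : 𝓢(R3, C3)) :
    ∫⁻ p, ‖fracCurlAdj s φ p‖ₑ ^ 2 ≤ ENNReal.ofReal ((‖crossCLM‖ * kernelFactor s) ^ 2) *
      (∫⁻ z : R3, ENNReal.ofReal (‖z‖ ^ (-(3 + 2 * s)) * min 4 (‖z‖ ^ 2))) *
        ∫⁻ p, ENNReal.ofReal (√(1 + ‖(2 * Real.pi) • p‖ ^ 2) ^ (2 * s)) * ‖(𝓕 φ) p‖ₑ ^ 2 := by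
  have hφ : Measurable φ := φ.continuous.measurable
  have hφ' : Measurable (fun p => (𝓕 φ) p) := (𝓕 φ).continuous.measurable
  calc ∫⁻ p, ‖fracCurlAdj s φ p‖ₑ ^ 2
      ≤ ∫⁻ p : R6, ENNReal.ofReal ((‖crossCLM‖ * kernelFactor s) ^ 2) *
        (ENNReal.ofReal (‖p.snd - p.fst‖ ^ (-(3 + 2 * s))) * ‖φ p.snd - φ p.fst‖ₑ ^ 2) :=
        lintegral_mono fun p => enorm_fracCurlAdj_sq_le hs φ p
    _ = ENNReal.ofReal ((‖crossCLM‖ * kernelFactor s) ^ 2) *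
        ∫⁻ z : R3, ∫⁻ x : R3, ENNReal.ofReal (‖z‖ ^ (-(3 + 2 * s))) * ‖φ (x + z) - φ x‖ₑ ^ 2 := by
        rw [lintegral_const_mul _ (by fun_prop),
          lintegral_R6_eq (f := fun q : R3 × R3 =>
            ENNReal.ofReal (‖q.2 - q.1‖ ^ (-(3 + 2 * s))) * ‖φ q.2 - φ q.1‖ₑ ^ 2) (by fun_prop)]
        simp only [add_sub_cancel_left]
    _ ≤ ENNReal.ofReal ((‖crossCLM‖ * kernelFactor s) ^ 2) *
        ∫⁻ z : R3, ∫⁻ p : R3, ENNReal.ofReal (‖z‖ ^ (-(3 + 2 * s))) *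
          (ENNReal.ofReal (min 4 ((‖z‖ * √(1 + ‖(2 * Real.pi) • p‖ ^ 2)) ^ 2)) *
            ‖(𝓕 φ) p‖ₑ ^ 2) := by
        refine mul_le_mul_right (lintegral_mono fun z => ?_) _
        rw [lintegral_const_mul _ (by fun_prop), lintegral_const_mul _ (by fun_prop)]
        exact mul_le_mul_right (lintegral_translate_sub_le φ z) _
    _ = ENNReal.ofReal ((‖crossCLM‖ * kernelFactor s) ^ 2) *
        ∫⁻ p : R3, ∫⁻ z : R3, ENNReal.ofReal (‖z‖ ^ (-(3 + 2 * s)) *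
          min 4 ((‖z‖ * √(1 + ‖(2 * Real.pi) • p‖ ^ 2)) ^ 2)) * ‖(𝓕 φ) p‖ₑ ^ 2 := by
        rw [lintegral_lintegral_swap (by fun_prop)]
        refine congrArg _ (lintegral_congr fun p => lintegral_congr fun z => ?_)
        rw [ENNReal.ofReal_mul (by positivity), mul_assoc]
    _ = _ := by
        rw [mul_assoc]
        refine congrArg _ ?_
        rw [← lintegral_const_mul _ (by fun_prop)]
        refine lintegral_congr fun p => ?_
        rw [lintegral_mul_const _ (by fun_prop),
          lintegral_rpow_mul_min_scale s (by positivity : 0 < √(1 + ‖(2 * Real.pi) • p‖ ^ 2))]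
        ring

theorem besselSymbol_id_enorm_sq (s : ℝ) (p : R3) :
    ‖besselSymbol (ContinuousLinearMap.id ℝ R3) s p‖ₑ ^ 2 =
      ENNReal.ofReal (√(1 + ‖(2 * Real.pi) • p‖ ^ 2) ^ (2 * s)) := by
  have h0 : 0 ≤ 1 + ‖(2 * Real.pi) • p‖ ^ 2 := by positivity
  rw [← ofReal_norm, besselSymbol, Complex.norm_real, Real.norm_of_nonneg (by positivity),
    ← ENNReal.ofReal_pow (by positivity), ContinuousLinearMap.id_apply, Real.sqrt_eq_rpow,
    ← Real.rpow_mul h0, ← Real.rpow_two, ← Real.rpow_mul h0]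
  ring_nf

theorem fourier_fourierMultiplierCLM_apply {E : Type*} [NormedAddCommGroup E]
    [InnerProductSpace ℝ E] [FiniteDimensional ℝ E] [MeasurableSpace E] [BorelSpace E]
    {σ : E → ℂ} (hσ : σ.HasTemperateGrowth) (φ : 𝓢(E, C3)) (p : E) :
    (𝓕 (SchwartzMap.fourierMultiplierCLM C3 σ φ)) p = σ p • (𝓕 φ) p := by
  rw [SchwartzMap.fourierMultiplierCLM_apply, fourier_fourierInv_eq,
    SchwartzMap.smulLeftCLM_apply_apply hσ]

theorem exists_eLpNorm_fracCurlAdj_le {s : ℝ} (hs : s ∈ Set.Ioo (0 : ℝ) 1) :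
    ∃ C : NNReal, ∀ φ : 𝓢(R3, C3), eLpNorm (fracCurlAdj s φ) 2 volume ≤
      C * eLpNorm (SchwartzMap.fourierMultiplierCLM C3
        (besselSymbol (ContinuousLinearMap.id ℝ R3) s) φ) 2 volume := by
  have hJ := lintegral_rpow_mul_min_lt_top hs
  set J := ∫⁻ z : R3, ENNReal.ofReal (‖z‖ ^ (-(3 + 2 * s)) * min 4 (‖z‖ ^ 2))
  have hK : ENNReal.ofReal ((‖crossCLM‖ * kernelFactor s) ^ 2) * J ≠ ⊤ :=
    ENNReal.mul_ne_top ENNReal.ofReal_ne_top hJ.ne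
  lift ENNReal.ofReal ((‖crossCLM‖ * kernelFactor s) ^ 2) * J to NNReal using hK with K hK'
  refine ⟨NNReal.sqrt K, fun φ => ?_⟩
  have hsq : ∀ {E : Type} [MeasurableSpace E] (μ : Measure E) (f : E → C3),
      eLpNorm f 2 μ ^ 2 = ∫⁻ x, ‖f x‖ₑ ^ 2 ∂μ := fun μ f => by
    have := eLpNorm_nnreal_pow_eq_lintegral (μ := μ) (f := f) (p := 2) two_ne_zero
    simpa using this
  have h := lintegral_enorm_fracCurlAdj_sq_le hs φ
  simp_rw [← besselSymbol_id_enorm_sq, ← mul_pow, ← enorm_smul,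
    ← fourier_fourierMultiplierCLM_apply (besselSymbol_temperate _ s)] at h
  rw [lintegral_enorm_sq_fourier, ← hsq, ← hsq] at h
  change _ ≤ ENNReal.ofReal ((‖crossCLM‖ * kernelFactor s) ^ 2) * J * _ at h
  rw [← hK'] at h
  rw [← ENNReal.pow_le_pow_left_iff two_ne_zero, mul_pow]
  refine h.trans_eq ?_
  congr 1
  norm_cast
  simp

theorem memLp_fracCurlAdj {s : ℝ} (hs : s ∈ Set.Ioo (0 : ℝ) 1) (φ : 𝓢(R3, C3)) :
    MemLp (fracCurlAdj s φ) 2 volume := by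
  obtain ⟨C, hC⟩ := exists_eLpNorm_fracCurlAdj_le hs
  exact ⟨(measurable_fracCurlAdj s φ).aestronglyMeasurable, (hC φ).trans_lt
    (ENNReal.mul_lt_top ENNReal.coe_lt_top (SchwartzMap.memLp _ 2 volume).2)⟩

/-! ### The vector Gaussian and its Fourier transform -/

/-- The vector field `z ↦ z e^{-t |z|²}`. -/
def gaussVec (t : ℝ) (z : R3) : C3 := Real.exp (-(t * ‖z‖ ^ 2)) • complexVec z

theorem gaussVec_neg (t : ℝ) (z : R3) : gaussVec t (-z) = -gaussVec t z := by
  have h : complexVec (-z) = -complexVec z := complexVecCLM.map_neg z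
  simp [gaussVec, h]

theorem integrable_norm_mul_gaussian {t : ℝ} (ht : 0 < t) :
    Integrable fun z : R3 => ‖z‖ * Real.exp (-(t * ‖z‖ ^ 2)) := by
  have h := (integrable_fun_norm_addHaar (volume : Measure R3)
    (f := fun y : ℝ => y * Real.exp (-(t * y ^ 2)))).mpr ?_
  · exact h
  · have h2 := (integrable_rpow_mul_exp_neg_mul_sq ht (s := 3) (by norm_num)).integrableOn
      (s := Set.Ioi 0)
    refine h2.congr_fun (fun y _ => ?_) measurableSet_Ioi
    simp only [finrank_euclideanSpace_fin, smul_eq_mul]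
    norm_num
    ring

theorem integrable_gaussVec {t : ℝ} (ht : 0 < t) : Integrable (gaussVec t) := by
  refine (integrable_norm_mul_gaussian ht).mono' ?_ (Filter.Eventually.of_forall fun z => ?_)
  · have : Continuous (gaussVec t) := by
      have := continuous_complexVec
      unfold gaussVec
      fun_prop
    exact this.aestronglyMeasurable
  · rw [gaussVec, norm_smul, norm_complexVec, Real.norm_of_nonneg (by positivity), mul_comm]

theorem hasFDerivAt_gaussian (t : ℝ) (z : R3) :
    HasFDerivAt (fun z : R3 => (Real.exp (-(t * ‖z‖ ^ 2)) : ℂ))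
      (Complex.ofRealCLM ∘L ((-2 * t * Real.exp (-(t * ‖z‖ ^ 2))) • innerSL ℝ z)) z := by
  have h1 : HasFDerivAt (fun z : R3 => -(t * ‖z‖ ^ 2)) (-(t • (2 • innerSL ℝ z))) z :=
    ((hasStrictFDerivAt_norm_sq z).hasFDerivAt.const_mul t).neg
  have h2 := Complex.ofRealCLM.hasFDerivAt.comp z h1.exp
  refine h2.congr_fderiv ?_
  congr 1
  ext v
  simp
  ring

/-- The field is `-(2t)⁻¹ ∇ e^{-t|z|²}`, so its transform is that of the scalar Gaussian times a
multiple of `iξ`. The power `5/2` is `3/2` from the Gaussian plus `1` from the gradient. -/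
theorem fourier_gaussVec {t : ℝ} (ht : 0 < t) (ξ : R3) :
    𝓕 (gaussVec t) ξ = (-Complex.I) • ((Real.pi ^ ((5 : ℝ) / 2) * t ^ (-(5 : ℝ) / 2) *
      Real.exp (-(Real.pi ^ 2 * ‖ξ‖ ^ 2 / t))) • complexVec ξ) := by
  let g : R3 → ℂ := fun z => (Real.exp (-(t * ‖z‖ ^ 2)) : ℂ)
  have hg : g = fun z : R3 => Complex.exp (-(t : ℂ) * ‖z‖ ^ 2) := by
    ext z
    simp [g]
  have hgi : Integrable g := by
    have := GaussianFourier.integrable_cexp_neg_mul_sq_norm_add (V := R3) (b := t) (by simpa using ht)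
      0 0
    rw [hg]
    simpa using this
  have hfd : ∀ z, fderiv ℝ g z =
      Complex.ofRealCLM ∘L ((-2 * t * Real.exp (-(t * ‖z‖ ^ 2))) • innerSL ℝ z) :=
    fun z => (hasFDerivAt_gaussian t z).fderiv
  have hfi : Integrable (fderiv ℝ g) := by
    refine ((integrable_norm_mul_gaussian ht).const_mul (2 * t)).mono'
      (measurable_fderiv ℝ g).aestronglyMeasurable (Filter.Eventually.of_forall fun z => ?_)
    rw [hfd]
    refine (ContinuousLinearMap.opNorm_comp_le _ _).trans ?_
    rw [Complex.ofRealCLM_norm, one_mul, norm_smul, innerSL_apply_norm, norm_mul, norm_mul,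
      Real.norm_of_nonneg ht.le, Real.norm_of_nonneg (Real.exp_pos _).le]
    norm_num
    apply le_of_eq
    ring
  have hF := Real.fourier_fderiv hgi (fun z => (hasFDerivAt_gaussian t z).differentiableAt) hfi
  have hgF : 𝓕 g ξ = ((Real.pi / t) ^ ((3 : ℝ) / 2) *
      Real.exp (-(Real.pi ^ 2 * ‖ξ‖ ^ 2 / t)) : ℝ) := by
    rw [hg, fourier_gaussian_innerProductSpace (by simpa using ht), finrank_euclideanSpace_fin]
    push_cast
    rw [Complex.ofReal_cpow (by positivity)]
    push_cast
    ring_nf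
  ext j
  have h1 : 𝓕 (gaussVec t) ξ j = 𝓕 (fun z => gaussVec t z j) ξ := by
    rw [Real.fourier_eq, Real.fourier_eq]
    have hi := (Real.fourierIntegral_convergent_iff ξ).mpr (integrable_gaussVec ht)
    exact ((EuclideanSpace.proj j : C3 →L[ℂ] ℂ).integral_comp_comm hi).symm
  have h2 : (fun z => gaussVec t z j) =
      fun z => (-(2 * t : ℂ)⁻¹) • fderiv ℝ g z (EuclideanSpace.single j 1) := by
    ext z
    have ht' : (t : ℂ) ≠ 0 := by exact_mod_cast ht.ne'
    rw [hfd]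
    simp [gaussVec, complexVec, EuclideanSpace.inner_single_right]
    field_simp
  have h3 : 𝓕 (fun z => (-(2 * t : ℂ)⁻¹) • fderiv ℝ g z (EuclideanSpace.single j 1)) ξ =
      (-(2 * t : ℂ)⁻¹) • 𝓕 (fun z => fderiv ℝ g z (EuclideanSpace.single j 1)) ξ :=
    congrFun (VectorFourier.fourierIntegral_const_smul Real.fourierChar volume (innerₗ R3) _ _) ξ
  have h4 : (Real.pi / t) * (Real.pi / t) ^ ((3 : ℝ) / 2) =
      Real.pi ^ ((5 : ℝ) / 2) * t ^ (-(5 : ℝ) / 2) := by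
    have hp : 0 < Real.pi / t := by positivity
    rw [← Real.rpow_one_add' hp.le (by norm_num), Real.div_rpow Real.pi_pos.le ht.le,
      neg_div, Real.rpow_neg ht.le]
    norm_num
    rfl
  rw [h1, h2, h3, ← Real.fourier_continuousLinearMap_apply hfi, hF, ← h4]
  have ht' : (t : ℂ) ≠ 0 := by exact_mod_cast ht.ne'
  have hin : innerSL ℝ ξ (EuclideanSpace.single j 1) = ξ j := by
    rw [innerSL_apply_apply]
    simp [EuclideanSpace.inner_single_right]
  simp [VectorFourier.fourierSMulRight_apply, hgF, complexVec, hin]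
  field_simp

/-! ### Fourier transforms of sheared products -/

/-- The measurable equivalence `(x, z) ↦ (x, x + z)`. -/
def shearEquiv : R3 × R3 ≃ᵐ R6 :=
  (MeasurableEquiv.shearAddRight R3).trans (MeasurableEquiv.toLp 2 (R3 × R3))

theorem shearEquiv_apply (q : R3 × R3) : shearEquiv q = WithLp.toLp 2 (q.1, q.1 + q.2) := rfl

theorem measurePreserving_shearEquiv : MeasurePreserving shearEquiv :=
  (WithLp.volume_preserving_toLp R3 R3).comp (measurePreserving_prod_add volume volume)

/-- The measurable equivalence `(x, z) ↦ (x + z, x)`. -/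
def shearEquivSwap : R3 × R3 ≃ᵐ R6 :=
  ((MeasurableEquiv.shearAddRight R3).trans MeasurableEquiv.prodComm).trans
    (MeasurableEquiv.toLp 2 (R3 × R3))

theorem shearEquivSwap_apply (q : R3 × R3) :
    shearEquivSwap q = WithLp.toLp 2 (q.1 + q.2, q.1) := rfl

theorem measurePreserving_shearEquivSwap : MeasurePreserving shearEquivSwap :=
  (WithLp.volume_preserving_toLp R3 R3).comp
    (Measure.measurePreserving_swap.comp (measurePreserving_prod_add volume volume))

section Shear

variable {k f : R3 → C3}

theorem integrable_cross_prod (hk : Integrable k) (hf : Integrable f) :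
    Integrable fun q : R3 × R3 => cross (k q.2) (f q.1) :=
  hf.op_fst_snd (op := fun a b => crossCLM.flip a b) crossCLM.flip.continuous₂
    ⟨‖crossCLM.flip‖, crossCLM.flip.le_opNorm₂⟩ hk

theorem integrable_cross_sub_fst (hk : Integrable k) (hf : Integrable f) :
    Integrable fun p : R6 => cross (k (p.snd - p.fst)) (f p.fst) := by
  rw [← measurePreserving_shearEquiv.integrable_comp_emb shearEquiv.measurableEmbedding]
  refine (integrable_cross_prod hk hf).congr (Filter.Eventually.of_forall fun q => ?_)
  simp [shearEquiv_apply]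

theorem integrable_cross_sub_snd (hk : Integrable k) (hf : Integrable f) :
    Integrable fun p : R6 => cross (k (p.snd - p.fst)) (f p.snd) := by
  rw [← measurePreserving_shearEquivSwap.integrable_comp_emb shearEquivSwap.measurableEmbedding]
  refine (integrable_cross_prod hk.comp_neg hf).congr (Filter.Eventually.of_forall fun q => ?_)
  simp [shearEquivSwap_apply]

theorem integral_phase_cross_prod (hk : Integrable k) (hf : Integrable f) (a b : R3) :
    ∫ q : R3 × R3, (Real.fourierChar (-inner ℝ q.1 a) * Real.fourierChar (-inner ℝ q.2 b)) •
      cross (k q.2) (f q.1) = cross (𝓕 k b) (𝓕 f a) := by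
  have h := integral_prod_bilin (μ := (volume : Measure R3)) (ν := (volume : Measure R3))
    crossCLM.flip ((Real.fourierIntegral_convergent_iff a).mpr hf)
    ((Real.fourierIntegral_convergent_iff b).mpr hk)
  rw [Real.fourier_eq, Real.fourier_eq]
  refine Eq.trans ?_ h
  refine integral_congr_ae (Filter.Eventually.of_forall fun q => ?_)
  simp only [Circle.smul_def, ContinuousLinearMap.flip_apply, map_smul, smul_apply, smul_smul,
    Circle.coe_mul, mul_comm]
  rfl

/-- With `y = x + z` the phase is `x·ξ + y·η = x·(ξ + η) + z·η`, so the integral factors. -/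
theorem fourier_cross_sub_fst (hk : Integrable k) (hf : Integrable f) (ζ : R6) :
    𝓕 (fun p : R6 => cross (k (p.snd - p.fst)) (f p.fst)) ζ =
      cross (𝓕 k ζ.snd) (𝓕 f (ζ.fst + ζ.snd)) := by
  rw [Real.fourier_eq, ← measurePreserving_shearEquiv.integral_comp shearEquiv.measurableEmbedding,
    ← integral_phase_cross_prod hk hf]
  refine integral_congr_ae (Filter.Eventually.of_forall fun q => ?_)
  simp only [shearEquiv_apply, WithLp.prod_inner_apply, WithLp.toLp_fst, WithLp.toLp_snd,
    add_sub_cancel_left, ← AddChar.map_add_eq_mul, inner_add_left, inner_add_right,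
    WithLp.ofLp_fst, WithLp.ofLp_snd]
  congr 2
  ring

/-- The same shear based at `y`, with `x = y + z`; the kernel is then reflected and carries the
frequency `ξ`. -/
theorem fourier_cross_sub_snd (hk : Integrable k) (hf : Integrable f) (ζ : R6) :
    𝓕 (fun p : R6 => cross (k (p.snd - p.fst)) (f p.snd)) ζ =
      cross (𝓕 (fun z => k (-z)) ζ.fst) (𝓕 f (ζ.fst + ζ.snd)) := by
  rw [Real.fourier_eq,
    ← measurePreserving_shearEquivSwap.integral_comp shearEquivSwap.measurableEmbedding,
    ← integral_phase_cross_prod hk.comp_neg hf]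
  refine integral_congr_ae (Filter.Eventually.of_forall fun q => ?_)
  simp only [shearEquivSwap_apply, WithLp.prod_inner_apply, WithLp.toLp_fst, WithLp.toLp_snd,
    sub_add_cancel_left, ← AddChar.map_add_eq_mul, inner_add_left, inner_add_right,
    WithLp.ofLp_fst, WithLp.ofLp_snd]
  congr 2
  ring

end Shear

/-- The two-point field with the Gaussian kernel `z e^{-t |z|²}`. -/
def gaussCurlAdj (t : ℝ) (φ : R3 → C3) (p : R6) : C3 :=
  cross (gaussVec t (p.snd - p.fst)) (φ p.snd - φ p.fst)

theorem integrable_gaussCurlAdj {t : ℝ} (ht : 0 < t) (φ : 𝓢(R3, C3)) :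
    Integrable (gaussCurlAdj t φ) := by
  have h := (integrable_cross_sub_snd (integrable_gaussVec ht) φ.integrable).sub
    (integrable_cross_sub_fst (integrable_gaussVec ht) φ.integrable)
  refine h.congr (Filter.Eventually.of_forall fun p => ?_)
  simp [gaussCurlAdj, cross_sub_right]

/-- The radial factor of the Fourier transform of `z e^{-t |z|²}`. -/
def gaussFactor (t r : ℝ) : ℝ :=
  Real.pi ^ ((5 : ℝ) / 2) * t ^ (-(5 : ℝ) / 2) * Real.exp (-(Real.pi ^ 2 * r ^ 2 / t))

/-- The kernel is odd, so the reflection changes a sign and the `ξ` and `η` terms add up. -/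
theorem fourier_gaussCurlAdj {t : ℝ} (ht : 0 < t) (φ : 𝓢(R3, C3)) (ζ : R6) :
    𝓕 (gaussCurlAdj t φ) ζ = Complex.I •
      (gaussFactor t ‖ζ.fst‖ • cross (complexVec ζ.fst) ((𝓕 φ) (ζ.fst + ζ.snd)) +
        gaussFactor t ‖ζ.snd‖ • cross (complexVec ζ.snd) ((𝓕 φ) (ζ.fst + ζ.snd))) := by
  have hi1 := integrable_cross_sub_snd (integrable_gaussVec ht) φ.integrable
  have hi2 := integrable_cross_sub_fst (integrable_gaussVec ht) φ.integrable
  have h : 𝓕 (gaussCurlAdj t φ) ζ =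
      𝓕 (fun p : R6 => cross (gaussVec t (p.snd - p.fst)) (φ p.snd)) ζ -
        𝓕 (fun p : R6 => cross (gaussVec t (p.snd - p.fst)) (φ p.fst)) ζ := by
    simp only [Real.fourier_eq]
    rw [← integral_sub ((Real.fourierIntegral_convergent_iff ζ).mpr hi1)
      ((Real.fourierIntegral_convergent_iff ζ).mpr hi2)]
    simp only [gaussCurlAdj, cross_sub_right, smul_sub]
  have hneg : 𝓕 (fun z => gaussVec t (-z)) ζ.fst = -𝓕 (gaussVec t) ζ.fst := by
    simp only [gaussVec_neg, Real.fourier_eq, smul_neg, integral_neg]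
  rw [h, fourier_cross_sub_snd (integrable_gaussVec ht) φ.integrable,
    fourier_cross_sub_fst (integrable_gaussVec ht) φ.integrable, hneg, fourier_gaussVec ht,
    fourier_gaussVec ht, ← SchwartzMap.fourier_coe]
  simp only [cross_neg_left, cross_smul_left, cross_real_smul_left, gaussFactor, neg_smul, neg_neg,
    smul_add, sub_neg_eq_add]

/-! ### Integrals over the Gaussian scale -/

/-- Because `a ≥ 0`, the integral of the norm over `t` is the norm of the integral over `t`, so
Tonelli needs only the field already integrated in `t`. Convergence in `t` is asked only where `V ≠
0`, which leaves out the diagonal and the zero frequencies. -/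
theorem integrable_smul_prod_Ioi {a : ℝ → R6 → ℝ} {V : R6 → C3}
    (ha : Measurable (Function.uncurry a)) (ha0 : ∀ t p, 0 < t → 0 ≤ a t p)
    (hV : AEStronglyMeasurable V volume)
    (hi : ∀ p, V p ≠ 0 → IntegrableOn (fun t => a t p) (Set.Ioi 0))
    (hI : Integrable fun p => (∫ t in Set.Ioi 0, a t p) • V p) :
    Integrable (fun q : ℝ × R6 => a q.1 q.2 • V q.2)
      ((volume.restrict (Set.Ioi 0)).prod volume) := by
  have hm : AEStronglyMeasurable (fun q : ℝ × R6 => a q.1 q.2 • V q.2)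
      ((volume.restrict (Set.Ioi 0)).prod volume) :=
    ha.aestronglyMeasurable.smul hV.comp_snd
  rw [integrable_prod_iff' hm]
  refine ⟨Filter.Eventually.of_forall fun p => ?_, ?_⟩
  · by_cases h : V p = 0
    · simp [h]
    · exact (hi p h).smul_const (V p)
  · refine hI.norm.congr (Filter.Eventually.of_forall fun p => ?_)
    have h0 : 0 ≤ ∫ t in Set.Ioi 0, a t p :=
      setIntegral_nonneg measurableSet_Ioi fun t ht => ha0 t p ht
    simp only [norm_smul]
    rw [integral_mul_const, Real.norm_of_nonneg h0]
    congr 1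
    exact setIntegral_congr_fun measurableSet_Ioi fun t ht => (Real.norm_of_nonneg (ha0 t p ht)).symm

theorem integral_setIntegral_smul_eq {a : ℝ → R6 → ℝ} {V : R6 → C3}
    (h : Integrable (fun q : ℝ × R6 => a q.1 q.2 • V q.2)
      ((volume.restrict (Set.Ioi 0)).prod volume)) :
    ∫ p, (∫ t in Set.Ioi 0, a t p) • V p = ∫ t in Set.Ioi 0, ∫ p, a t p • V p := by
  rw [integral_integral_swap h]
  refine integral_congr_ae (Filter.Eventually.of_forall fun p => ?_)
  exact (integral_smul_const _ _).symm

theorem setIntegral_rpow_mul_exp_neg_mul_sq {β r : ℝ} (hβ : 0 < β) (hr : 0 < r) :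
    ∫ t in Set.Ioi (0 : ℝ), t ^ (β - 1) * Real.exp (-(t * r ^ 2)) =
      Real.Gamma β * (r ^ (2 * β))⁻¹ := by
  have h := Real.integral_rpow_mul_exp_neg_mul_Ioi hβ (pow_pos hr 2)
  simp_rw [mul_comm (r ^ 2)] at h
  rw [h, one_div, Real.inv_rpow (by positivity), ← Real.rpow_two, ← Real.rpow_mul hr.le, mul_comm]

/-- The integral of a non-integrable function is `0` by convention, so a nonzero value certifies
integrability. -/
theorem integrableOn_of_setIntegral_ne_zero {f : ℝ → ℝ} {c : ℝ} (hc : c ≠ 0)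
    (h : ∫ t in Set.Ioi (0 : ℝ), f t = c) : IntegrableOn f (Set.Ioi 0) := by
  by_contra hn
  exact hc (h ▸ integral_undef hn)

/-- The Gamma integral after `t ↦ 1/t`. -/
theorem setIntegral_rpow_mul_exp_neg_div {γ c : ℝ} (hγ : 0 < γ) (hc : 0 < c) :
    ∫ t in Set.Ioi (0 : ℝ), t ^ (-γ - 1) * Real.exp (-(c / t)) =
      Real.Gamma γ * (c ^ γ)⁻¹ := by
  have h := Real.integral_rpow_mul_exp_neg_mul_Ioi hγ hc
  rw [← integral_comp_rpow_Ioi _ (neg_ne_zero.mpr one_ne_zero), one_div,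
    Real.inv_rpow hc.le, mul_comm] at h
  rw [← h]
  refine setIntegral_congr_fun measurableSet_Ioi fun t ht => ?_
  have ht' : 0 < t := ht
  simp only [smul_eq_mul, Real.rpow_neg_one, abs_neg, abs_one, one_mul]
  rw [← mul_assoc, Real.inv_rpow ht'.le, ← Real.rpow_neg ht'.le, ← Real.rpow_add ht',
    div_eq_mul_inv]
  ring_nf

theorem setIntegral_rpow_mul_gaussFactor {s r : ℝ} (hs : s < 5 / 2) (hr : 0 < r) :
    ∫ t in Set.Ioi (0 : ℝ), t ^ ((5 / 4 + s / 2) - 1) * gaussFactor t r =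
      Real.pi ^ s * Real.Gamma (5 / 4 - s / 2) * (r ^ ((3 : ℝ) / 2 + 1 - s))⁻¹ := by
  have h := setIntegral_rpow_mul_exp_neg_div (γ := 5 / 4 - s / 2) (c := Real.pi ^ 2 * r ^ 2)
    (by linarith) (by positivity)
  have h1 : ∀ t ∈ Set.Ioi (0 : ℝ), t ^ ((5 / 4 + s / 2) - 1) * gaussFactor t r =
      Real.pi ^ ((5 : ℝ) / 2) * (t ^ (-(5 / 4 - s / 2) - 1) *
        Real.exp (-(Real.pi ^ 2 * r ^ 2 / t))) := fun t ht => by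
    have ht' : 0 < t := ht
    rw [gaussFactor, show -(5 / 4 - s / 2) - 1 = ((5 / 4 + s / 2) - 1) + (-(5 : ℝ) / 2) by ring,
      Real.rpow_add ht']
    ring
  rw [setIntegral_congr_fun measurableSet_Ioi h1, integral_const_mul, h,
    Real.mul_rpow (by positivity) (by positivity), ← Real.rpow_two, ← Real.rpow_two,
    ← Real.rpow_mul Real.pi_pos.le, ← Real.rpow_mul hr.le]
  have h2 : Real.pi ^ ((5 : ℝ) / 2) = Real.pi ^ s * Real.pi ^ (2 * (5 / 4 - s / 2)) := by
    rw [← Real.rpow_add Real.pi_pos]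
    ring_nf
  have h3 : (0 : ℝ) < Real.pi ^ (2 * (5 / 4 - s / 2)) := by positivity
  rw [h2, show 2 * (5 / 4 - s / 2) = (3 : ℝ) / 2 + 1 - s by ring] at *
  field_simp

/-! ### Integrability of the symbol -/

/-- An integrable weight on `ℝ³ × ℝ³`. -/
def prodWeight (ζ : R6) : ℝ := ((1 + ‖ζ.fst‖) ^ 4)⁻¹ * ((1 + ‖ζ.snd‖) ^ 4)⁻¹

theorem prodWeight_pos (ζ : R6) : 0 < prodWeight ζ := by
  unfold prodWeight
  positivity

theorem continuous_prodWeight : Continuous prodWeight := by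
  have h1 : ∀ ζ : R6, (1 + ‖ζ.fst‖) ^ 4 ≠ 0 := fun ζ => by positivity
  have h2 : ∀ ζ : R6, (1 + ‖ζ.snd‖) ^ 4 ≠ 0 := fun ζ => by positivity
  unfold prodWeight
  fun_prop (disch := assumption)

theorem exists_norm_le_prodWeight (g : 𝓢(R6, ℂ)) : ∃ C : ℝ, ∀ ζ, ‖g ζ‖ ≤ C * prodWeight ζ := by
  -- Decay of order `8` of `g` splits into order `4` in each variable, since `‖ζ.fst‖, ‖ζ.snd‖ ≤
  -- ‖ζ‖`.
  refine ⟨2 ^ 8 * ((Finset.Iic (8, 0)).sup fun m => SchwartzMap.seminorm ℝ m.1 m.2) g,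
    fun ζ => ?_⟩
  have h := SchwartzMap.one_add_le_sup_seminorm_apply (𝕜 := ℝ) (m := (8, 0)) le_rfl le_rfl g ζ
  rw [norm_iteratedFDeriv_zero] at h
  have h1 : ‖ζ.fst‖ ≤ ‖ζ‖ := WithLp.norm_fst_le R3 ζ
  have h2 : ‖ζ.snd‖ ≤ ‖ζ‖ := WithLp.norm_snd_le R3 ζ
  have h3 : (1 + ‖ζ.fst‖) ^ 4 * (1 + ‖ζ.snd‖) ^ 4 * ‖g ζ‖ ≤ (1 + ‖ζ‖) ^ 8 * ‖g ζ‖ := by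
    rw [show (1 + ‖ζ‖) ^ 8 = (1 + ‖ζ‖) ^ 4 * (1 + ‖ζ‖) ^ 4 by ring]
    gcongr
  rw [prodWeight, ← mul_inv, ← div_eq_mul_inv, le_div_iff₀ (by positivity), mul_comm]
  exact h3.trans h

theorem integrable_fst_mul_snd_R6 {f g : R3 → ℝ} (hf : Integrable f) (hg : Integrable g) :
    Integrable fun ζ : R6 => f ζ.fst * g ζ.snd :=
  ((WithLp.volume_preserving_ofLp R3 R3).integrable_comp_emb
    (MeasurableEquiv.toLp 2 (R3 × R3)).symm.measurableEmbedding).mpr (hf.mul_prod hg)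

theorem integrable_inv_one_add_norm_pow : Integrable fun z : R3 => ((1 + ‖z‖) ^ 4)⁻¹ := by
  refine integrable_comp_norm_of_rpow_bounds (f := fun y => ((1 + y) ^ 4)⁻¹) (by fun_prop)
    (C := 1) (a := 0) (b := -4) (by norm_num) (by norm_num) ?_ ?_
  · intro y hy _
    rw [abs_of_nonneg (by positivity), Real.rpow_zero, mul_one]
    exact inv_le_one_of_one_le₀ (one_le_pow₀ (by linarith))
  · intro y hy
    have hy0 : 0 < y := one_pos.trans hy
    rw [abs_of_nonneg (by positivity), one_mul, Real.rpow_neg hy0.le]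
    norm_cast
    gcongr
    linarith

theorem integrable_rpow_mul_inv_one_add_norm_pow {b : ℝ} (hb : -3 < b) (hb' : b < 1) :
    Integrable fun z : R3 => ‖z‖ ^ b * ((1 + ‖z‖) ^ 4)⁻¹ := by
  refine integrable_comp_norm_of_rpow_bounds (f := fun y => y ^ b * ((1 + y) ^ 4)⁻¹)
    (by fun_prop) (C := 1) (a := b) (b := b - 4) hb (by linarith) ?_ ?_
  · intro y hy _
    rw [abs_of_nonneg (by positivity), one_mul]
    exact mul_le_of_le_one_right (by positivity)
      (inv_le_one_of_one_le₀ (one_le_pow₀ (by linarith)))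
  · intro y hy
    have hy0 : 0 < y := one_pos.trans hy
    rw [abs_of_nonneg (by positivity), one_mul, sub_eq_add_neg, Real.rpow_add hy0,
      Real.rpow_neg hy0.le]
    norm_cast
    gcongr
    linarith

theorem integrable_rpow_fst_mul_prodWeight {b : ℝ} (hb : -3 < b) (hb' : b < 1) :
    Integrable fun ζ : R6 => ‖ζ.fst‖ ^ b * prodWeight ζ :=
  (integrable_fst_mul_snd_R6 (integrable_rpow_mul_inv_one_add_norm_pow hb hb')
    integrable_inv_one_add_norm_pow).congr
    (Filter.Eventually.of_forall fun ζ => by simp only [prodWeight]; ring)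

theorem integrable_rpow_snd_mul_prodWeight {b : ℝ} (hb : -3 < b) (hb' : b < 1) :
    Integrable fun ζ : R6 => ‖ζ.snd‖ ^ b * prodWeight ζ :=
  (integrable_fst_mul_snd_R6 integrable_inv_one_add_norm_pow
    (integrable_rpow_mul_inv_one_add_norm_pow hb hb')).congr
    (Filter.Eventually.of_forall fun ζ => by simp only [prodWeight]; ring)

/-! ### The Fourier transform of the adjoint fractional curl -/

/-- The vector symbol of the adjoint fractional curl. -/
def fourierSymbol (s : ℝ) (ζ : R6) : R3 :=
  (‖ζ.fst‖ ^ ((3 : ℝ) / 2 + 1 - s))⁻¹ • ζ.fst + (‖ζ.snd‖ ^ ((3 : ℝ) / 2 + 1 - s))⁻¹ • ζ.snd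

/-- The constant in the Fourier representation with kernel `e^{-2πi x·ξ}`. -/
def symbolConst (s : ℝ) : ℝ :=
  kernelFactor s * Real.pi ^ s * Real.Gamma (5 / 4 - s / 2) / Real.Gamma (5 / 4 + s / 2)

theorem symbolConst_pos {s : ℝ} (hs : s ∈ Set.Ioo (0 : ℝ) 1) : 0 < symbolConst s := by
  have h1 := kernelFactor_pos hs
  have h2 : 0 < Real.Gamma (5 / 4 - s / 2) := Real.Gamma_pos_of_pos (by linarith [hs.2])
  have h3 : 0 < Real.Gamma (5 / 4 + s / 2) := Real.Gamma_pos_of_pos (by linarith [hs.1])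
  have := Real.pi_pos
  unfold symbolConst
  positivity

/-- The field `i κ (ξ |ξ|^{s-5/2} + η |η|^{s-5/2}) × φ̂(ξ + η)`. -/
def fourierField (s : ℝ) (φ : 𝓢(R3, C3)) (ζ : R6) : C3 :=
  (symbolConst s * Complex.I) •
    cross (complexVec (fourierSymbol s ζ)) ((𝓕 φ) (ζ.fst + ζ.snd))

theorem measurable_complexVec_cross {v : R6 → R3} (hv : Measurable v) (φ : 𝓢(R3, C3)) :
    Measurable fun ζ : R6 => cross (complexVec (v ζ)) ((𝓕 φ) (ζ.fst + ζ.snd)) :=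
  measurable_cross (continuous_complexVec.measurable.comp hv)
    ((𝓕 φ).continuous.measurable.comp (by fun_prop))

theorem measurable_fourierSymbol (s : ℝ) : Measurable (fourierSymbol s) := by
  unfold fourierSymbol
  fun_prop

theorem measurable_fourierField (s : ℝ) (φ : 𝓢(R3, C3)) : Measurable (fourierField s φ) :=
  (measurable_complexVec_cross (measurable_fourierSymbol s) φ).const_smul (symbolConst s * Complex.I)

theorem complexVec_zero : complexVec 0 = 0 := complexVecCLM.map_zero

theorem cross_zero_left (v : C3) : cross 0 v = 0 := by simp [← crossCLM_apply]

/-- The Gamma integral with `β = 5/4 + s/2`, as `2β = 3/2 + s + 1`. On the diagonal the cross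
product vanishes on both sides. -/
theorem fracCurlAdj_eq_setIntegral {s : ℝ} (hs : s ∈ Set.Ioo (0 : ℝ) 1) (φ : R3 → C3) (p : R6) :
    fracCurlAdj s φ p = (kernelFactor s / Real.Gamma (5 / 4 + s / 2)) •
      (∫ t in Set.Ioi (0 : ℝ), t ^ ((5 / 4 + s / 2) - 1) *
        Real.exp (-(t * ‖p.snd - p.fst‖ ^ 2))) •
          cross (complexVec (p.snd - p.fst)) (φ p.snd - φ p.fst) := by
  have he : fracKernel s p.fst p.snd =
      (kernelFactor s / ‖p.snd - p.fst‖ ^ ((3 : ℝ) / 2 + s + 1)) • (p.snd - p.fst) := rfl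
  rw [fracCurlAdj, he]
  rcases eq_or_ne (p.snd - p.fst) 0 with h | h
  · rw [h, smul_zero, complexVec_zero, cross_zero_left, smul_zero, smul_zero]
  · have hG : 0 < Real.Gamma (5 / 4 + s / 2) := Real.Gamma_pos_of_pos (by linarith [hs.1])
    rw [setIntegral_rpow_mul_exp_neg_mul_sq (by linarith [hs.1]) (norm_pos_iff.mpr h),
      complexVec_smul, cross_real_smul_left, smul_smul,
      show 2 * (5 / 4 + s / 2) = (3 : ℝ) / 2 + s + 1 by ring]
    congr 1
    generalize Real.Gamma (5 / 4 + s / 2) = G at *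
    field_simp

theorem smul_fracCurlAdj_eq_setIntegral {s : ℝ} (hs : s ∈ Set.Ioo (0 : ℝ) 1) (φ : R3 → C3)
    (g : 𝓢(R6, ℂ)) (p : R6) :
    g p • fracCurlAdj s φ p = (kernelFactor s / Real.Gamma (5 / 4 + s / 2)) •
      (∫ t in Set.Ioi (0 : ℝ), t ^ ((5 / 4 + s / 2) - 1) *
        Real.exp (-(t * ‖p.snd - p.fst‖ ^ 2))) •
          g p • cross (complexVec (p.snd - p.fst)) (φ p.snd - φ p.fst) := by
  rw [fracCurlAdj_eq_setIntegral hs, smul_comm (g p), smul_comm (g p)]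

theorem integrable_smul_fracCurlAdj {s : ℝ} (hs : s ∈ Set.Ioo (0 : ℝ) 1) (φ : 𝓢(R3, C3))
    (g : 𝓢(R6, ℂ)) : Integrable fun p => g p • fracCurlAdj s φ p :=
  memLp_one_iff_integrable.mp ((memLp_fracCurlAdj hs φ).smul (g.memLp 2 volume) (r := 1))

/-- Integrating in `t` first returns a multiple of `g · C*φ`, a product of two `L²` functions; this
is where the `L²` bound enters the Fourier formula. -/
theorem integrable_physical {s : ℝ} (hs : s ∈ Set.Ioo (0 : ℝ) 1) (φ : 𝓢(R3, C3))
    (g : 𝓢(R6, ℂ)) :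
    Integrable (fun q : ℝ × R6 => (q.1 ^ ((5 / 4 + s / 2) - 1) *
      Real.exp (-(q.1 * ‖q.2.snd - q.2.fst‖ ^ 2))) •
        g q.2 • cross (complexVec (q.2.snd - q.2.fst)) (φ q.2.snd - φ q.2.fst))
      ((volume.restrict (Set.Ioi 0)).prod volume) := by
  have hG : 0 < Real.Gamma (5 / 4 + s / 2) := Real.Gamma_pos_of_pos (by linarith [hs.1])
  have hA := kernelFactor_pos hs
  have hm : Measurable fun p : R6 =>
      cross (complexVec (p.snd - p.fst)) (φ p.snd - φ p.fst) :=
    measurable_cross (continuous_complexVec.measurable.comp (by fun_prop))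
      ((φ.continuous.measurable.comp (by fun_prop)).sub
        (φ.continuous.measurable.comp (by fun_prop)))
  refine integrable_smul_prod_Ioi
    (a := fun t p => t ^ ((5 / 4 + s / 2) - 1) * Real.exp (-(t * ‖p.snd - p.fst‖ ^ 2)))
    (V := fun p => g p • cross (complexVec (p.snd - p.fst)) (φ p.snd - φ p.fst))
    ?_ (fun t p ht => by positivity) ?_ ?_ ?_
  · unfold Function.uncurry
    fun_prop
  · exact (g.continuous.measurable.smul hm).aestronglyMeasurable
  · intro p hp
    have h : p.snd - p.fst ≠ 0 := fun h => hp (by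
      rw [h, complexVec_zero, cross_zero_left, smul_zero])
    have hr : 0 < ‖p.snd - p.fst‖ := norm_pos_iff.mpr h
    refine integrableOn_of_setIntegral_ne_zero ?_
      (setIntegral_rpow_mul_exp_neg_mul_sq (by linarith [hs.1]) hr)
    positivity
  · have h := integrable_smul_fracCurlAdj hs φ g
    refine (h.smul (kernelFactor s / Real.Gamma (5 / 4 + s / 2))⁻¹).congr
      (Filter.Eventually.of_forall fun p => ?_)
    simp only [Pi.smul_apply]
    rw [smul_fracCurlAdj_eq_setIntegral hs, smul_smul, inv_mul_cancel₀ (by positivity), one_smul]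

theorem setIntegral_gaussFactor_smul {s : ℝ} (hs : s ∈ Set.Ioo (0 : ℝ) 1) (v : R3) (w : C3) :
    (∫ t in Set.Ioi (0 : ℝ), t ^ ((5 / 4 + s / 2) - 1) * gaussFactor t ‖v‖) •
      cross (complexVec v) w = (Real.pi ^ s * Real.Gamma (5 / 4 - s / 2)) •
        cross (complexVec ((‖v‖ ^ ((3 : ℝ) / 2 + 1 - s))⁻¹ • v)) w := by
  rcases eq_or_ne v 0 with rfl | h
  · rw [smul_zero, complexVec_zero, cross_zero_left, smul_zero, smul_zero]
  · rw [setIntegral_rpow_mul_gaussFactor (by linarith [hs.2]) (norm_pos_iff.mpr h),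
      complexVec_smul, cross_real_smul_left, smul_smul]

theorem norm_cross_symbol_le (s : ℝ) (φ : 𝓢(R3, C3)) (v p : R3) :
    ‖cross (complexVec ((‖v‖ ^ ((3 : ℝ) / 2 + 1 - s))⁻¹ • v)) ((𝓕 φ) p)‖ ≤
      ‖crossCLM‖ * SchwartzMap.seminorm ℝ 0 0 (𝓕 φ) * ‖v‖ ^ (s - 3 / 2) := by
  have h1 : ‖(‖v‖ ^ ((3 : ℝ) / 2 + 1 - s))⁻¹ • v‖ ≤ ‖v‖ ^ (s - 3 / 2) := by
    rw [norm_smul, Real.norm_of_nonneg (by positivity)]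
    rcases (norm_nonneg v).eq_or_lt with h0 | h0
    · rw [← h0, mul_zero]
      exact Real.rpow_nonneg le_rfl _
    · rw [← Real.rpow_neg h0.le, ← Real.rpow_add_one h0.ne']
      ring_nf
      exact le_rfl
  have h2 : ‖(𝓕 φ) p‖ ≤ SchwartzMap.seminorm ℝ 0 0 (𝓕 φ) := (𝓕 φ).norm_le_seminorm ℝ p
  have h3 := norm_cross_le (complexVec ((‖v‖ ^ ((3 : ℝ) / 2 + 1 - s))⁻¹ • v)) ((𝓕 φ) p)
  rw [norm_complexVec] at h3
  refine h3.trans ?_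
  rw [mul_right_comm]
  gcongr

theorem integrable_smul_cross_symbol (s : ℝ) (φ : 𝓢(R3, C3)) (g : 𝓢(R6, ℂ)) {π : R6 → R3}
    (hπ : Measurable π) (hw : Integrable fun ζ => ‖π ζ‖ ^ (s - 3 / 2) * prodWeight ζ) :
    Integrable fun ζ => g ζ • cross
        (complexVec ((‖π ζ‖ ^ ((3 : ℝ) / 2 + 1 - s))⁻¹ • π ζ)) ((𝓕 φ) (ζ.fst + ζ.snd)) := by
  obtain ⟨C, hC⟩ := exists_norm_le_prodWeight g
  have hm : Measurable fun ζ : R6 => cross (complexVec ((‖π ζ‖ ^ ((3 : ℝ) / 2 + 1 - s))⁻¹ • π ζ))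
      ((𝓕 φ) (ζ.fst + ζ.snd)) := measurable_complexVec_cross (by fun_prop) φ
  have hb := fun ζ : R6 => norm_cross_symbol_le s φ (π ζ) (ζ.fst + ζ.snd)
  generalize hW : (fun ζ : R6 => cross (complexVec ((‖π ζ‖ ^ ((3 : ℝ) / 2 + 1 - s))⁻¹ • π ζ))
      ((𝓕 φ) (ζ.fst + ζ.snd))) = W at hm
  have hW' := fun ζ => congrFun hW ζ
  beta_reduce at hW'
  simp only [hW'] at hb ⊢
  refine (hw.const_mul (C * (‖crossCLM‖ * SchwartzMap.seminorm ℝ 0 0 (𝓕 φ)))).mono'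
    (g.continuous.measurable.smul hm).aestronglyMeasurable
    (Filter.Eventually.of_forall fun ζ => ?_)
  rw [norm_smul]
  have hC0 : 0 ≤ C * prodWeight ζ := (norm_nonneg _).trans (hC ζ)
  exact (mul_le_mul (hC ζ) (hb ζ) (norm_nonneg _) hC0).trans_eq (by ring)

/-- Integrating in `t` first leaves a singularity of size `|π ζ|^{s-3/2}`, which `hw` makes
integrable against the decay of `g`. -/
theorem integrable_frequency {s : ℝ} (hs : s ∈ Set.Ioo (0 : ℝ) 1) (φ : 𝓢(R3, C3))
    (g : 𝓢(R6, ℂ)) {π : R6 → R3} (hπ : Measurable π)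
    (hw : Integrable fun ζ => ‖π ζ‖ ^ (s - 3 / 2) * prodWeight ζ) :
    Integrable (fun q : ℝ × R6 => (q.1 ^ ((5 / 4 + s / 2) - 1) * gaussFactor q.1 ‖π q.2‖) •
        g q.2 • cross (complexVec (π q.2)) ((𝓕 φ) (q.2.fst + q.2.snd)))
      ((volume.restrict (Set.Ioi 0)).prod volume) := by
  have hG : 0 < Real.Gamma (5 / 4 - s / 2) := Real.Gamma_pos_of_pos (by linarith [hs.2])
  have hpi := Real.pi_pos
  have hV := measurable_complexVec_cross hπ φ
  have h0 : ∀ ζ : R6, π ζ = 0 → cross (complexVec (π ζ)) ((𝓕 φ) (ζ.fst + ζ.snd)) = 0 :=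
    fun ζ h => by rw [h, complexVec_zero, cross_zero_left]
  have hb := (integrable_smul_cross_symbol s φ g hπ hw).smul
    (Real.pi ^ s * Real.Gamma (5 / 4 - s / 2))
  have hi : ∀ ζ : R6, (∫ t in Set.Ioi (0 : ℝ), t ^ ((5 / 4 + s / 2) - 1) *
      gaussFactor t ‖π ζ‖) • g ζ • cross (complexVec (π ζ)) ((𝓕 φ) (ζ.fst + ζ.snd)) =
      (Real.pi ^ s * Real.Gamma (5 / 4 - s / 2)) • g ζ • cross
        (complexVec ((‖π ζ‖ ^ ((3 : ℝ) / 2 + 1 - s))⁻¹ • π ζ)) ((𝓕 φ) (ζ.fst + ζ.snd)) :=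
    fun ζ => by rw [smul_comm _ (g ζ), smul_comm _ (g ζ), setIntegral_gaussFactor_smul hs]
  replace hb := hb.congr (Filter.Eventually.of_forall fun ζ => (hi ζ).symm)
  clear hi
  generalize hW : (fun ζ : R6 => cross (complexVec (π ζ)) ((𝓕 φ) (ζ.fst + ζ.snd))) = W at hV
  have hW' := fun ζ => congrFun hW ζ
  beta_reduce at hW'
  simp only [hW'] at hb h0 ⊢
  refine integrable_smul_prod_Ioi
    (a := fun t ζ => t ^ ((5 / 4 + s / 2) - 1) * gaussFactor t ‖π ζ‖)
    (V := fun ζ => g ζ • W ζ)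
    ?_ (fun t ζ ht => by unfold gaussFactor; positivity) ?_ ?_ hb
  · unfold Function.uncurry gaussFactor
    fun_prop
  · exact (g.continuous.measurable.smul hV).aestronglyMeasurable
  · intro ζ hζ
    have h : π ζ ≠ 0 := fun h => hζ (by rw [h0 ζ h, smul_zero])
    have hr : 0 < ‖π ζ‖ := norm_pos_iff.mpr h
    refine integrableOn_of_setIntegral_ne_zero ?_
      (setIntegral_rpow_mul_gaussFactor (by linarith [hs.2]) hr)
    positivity

theorem integral_fourier_smul_eq_of_integrable {E F : Type*} [NormedAddCommGroup E]
    [InnerProductSpace ℝ E] [FiniteDimensional ℝ E] [MeasurableSpace E] [BorelSpace E]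
    [NormedAddCommGroup F] [NormedSpace ℂ F] [CompleteSpace F] (g : 𝓢(E, ℂ)) {f : E → F}
    (hf : Integrable f) : ∫ p, (𝓕 g) p • f p = ∫ ζ, g ζ • 𝓕 f ζ := by
  have h := VectorFourier.integral_fourierIntegral_smul_eq_flip (L := innerₗ E) (μ := volume)
    (ν := volume) Real.continuous_fourierChar continuous_inner g.integrable hf
  rw [flip_innerₗ] at h
  exact h

/-- Both sides are integrals over `t` of Gaussian pairings, equal for each `t` by the multiplication
formula `∫ ĝ f = ∫ g f̂`. -/
theorem integral_fourier_smul_fracCurlAdj {s : ℝ} (hs : s ∈ Set.Ioo (0 : ℝ) 1) (φ : 𝓢(R3, C3))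
    (g : 𝓢(R6, ℂ)) :
    ∫ p, (𝓕 g) p • fracCurlAdj s φ p = ∫ ζ, g ζ • fourierField s φ ζ := by
  have hw1 := integrable_rpow_fst_mul_prodWeight (b := s - 3 / 2) (by linarith [hs.1])
    (by linarith [hs.2])
  have hw2 := integrable_rpow_snd_mul_prodWeight (b := s - 3 / 2) (by linarith [hs.1])
    (by linarith [hs.2])
  have hi1 := integrable_frequency hs φ g (π := fun ζ => ζ.fst) (by fun_prop) hw1
  have hi2 := integrable_frequency hs φ g (π := fun ζ => ζ.snd) (by fun_prop) hw2
  have hp := integrable_physical hs φ (𝓕 g)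
  have hA := smul_fracCurlAdj_eq_setIntegral hs φ (𝓕 g)
  have hB : ∀ ζ, g ζ • fourierField s φ ζ =
      (kernelFactor s / Real.Gamma (5 / 4 + s / 2)) • Complex.I •
        ((∫ t in Set.Ioi (0 : ℝ), t ^ ((5 / 4 + s / 2) - 1) * gaussFactor t ‖ζ.fst‖) •
            g ζ • cross (complexVec ζ.fst) ((𝓕 φ) (ζ.fst + ζ.snd)) +
          (∫ t in Set.Ioi (0 : ℝ), t ^ ((5 / 4 + s / 2) - 1) * gaussFactor t ‖ζ.snd‖) •
            g ζ • cross (complexVec ζ.snd) ((𝓕 φ) (ζ.fst + ζ.snd))) := fun ζ => by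
    rw [smul_comm _ (g ζ), smul_comm _ (g ζ), setIntegral_gaussFactor_smul hs,
      setIntegral_gaussFactor_smul hs, ← smul_add, ← smul_add, ← cross_add_left, ← complexVec_add,
      fourierField, symbolConst]
    change g ζ • _ • cross (complexVec (fourierSymbol s ζ)) _ =
      _ • _ • g ζ • _ • cross (complexVec (fourierSymbol s ζ)) _
    generalize cross (complexVec (fourierSymbol s ζ)) _ = w
    simp only [← Complex.coe_smul, smul_smul]
    congr 1
    push_cast
    ring
  simp_rw [hA, hB]
  rw [integral_smul, integral_smul, integral_smul, integral_setIntegral_smul_eq hp]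
  congr 1
  have hs1 := hi1.integral_prod_right
  have hs2 := hi2.integral_prod_right
  simp only [integral_smul_const] at hs1 hs2
  rw [integral_add hs1 hs2,
    integral_setIntegral_smul_eq hi1, integral_setIntegral_smul_eq hi2,
    ← integral_add hi1.integral_prod_left hi2.integral_prod_left, ← integral_smul]
  refine integral_congr_ae ?_
  filter_upwards [hi1.prod_right_ae, hi2.prod_right_ae, ae_restrict_mem measurableSet_Ioi]
    with t h1 h2 ht
  have h3 : ∀ (G : 𝓢(R6, ℂ)) (p : R6),
      (t ^ ((5 / 4 + s / 2) - 1) * Real.exp (-(t * ‖p.snd - p.fst‖ ^ 2))) •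
        G p • cross (complexVec (p.snd - p.fst)) (φ p.snd - φ p.fst) =
          t ^ ((5 / 4 + s / 2) - 1) • G p • gaussCurlAdj t φ p := fun G p => by
    rw [gaussCurlAdj, gaussVec, cross_real_smul_left, mul_smul, smul_comm (G p)]
  simp_rw [h3]
  rw [integral_smul, integral_fourier_smul_eq_of_integrable g (integrable_gaussCurlAdj ht φ),
    ← integral_smul, ← integral_add h1 h2, ← integral_smul]
  refine integral_congr_ae (Filter.Eventually.of_forall fun ζ => ?_)
  simp only [fourier_gaussCurlAdj ht, mul_smul, smul_add]
  rw [smul_comm (g ζ), smul_comm (g ζ), smul_comm (g ζ), smul_comm (g ζ),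
    smul_comm _ Complex.I, smul_comm _ Complex.I]

theorem norm_fourierField_le (s : ℝ) (φ : 𝓢(R3, C3)) (ζ : R6) :
    ‖fourierField s φ ζ‖ ≤ |symbolConst s| * (‖crossCLM‖ * SchwartzMap.seminorm ℝ 0 0 (𝓕 φ)) *
      (‖ζ.fst‖ ^ (s - 3 / 2) + ‖ζ.snd‖ ^ (s - 3 / 2)) := by
  have h1 := norm_cross_symbol_le s φ ζ.fst (ζ.fst + ζ.snd)
  have h2 := norm_cross_symbol_le s φ ζ.snd (ζ.fst + ζ.snd)
  have h3 := (norm_add_le _ _).trans (add_le_add h1 h2)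
  rw [← cross_add_left, ← complexVec_add] at h3
  have hc : ‖(symbolConst s : ℂ) * Complex.I‖ = |symbolConst s| := by simp
  rw [fourierField, norm_smul, hc, mul_assoc, mul_add]
  exact mul_le_mul_of_nonneg_left h3 (abs_nonneg _)

theorem locallyIntegrable_fourierField {s : ℝ} (hs : s ∈ Set.Ioo (0 : ℝ) 1) (φ : 𝓢(R3, C3)) :
    LocallyIntegrable (fourierField s φ) := by
  have hw1 := integrable_rpow_fst_mul_prodWeight (b := s - 3 / 2) (by linarith [hs.1])
    (by linarith [hs.2])
  have hw2 := integrable_rpow_snd_mul_prodWeight (b := s - 3 / 2) (by linarith [hs.1])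
    (by linarith [hs.2])
  have hi : Integrable fun ζ => prodWeight ζ • fourierField s φ ζ := by
    refine ((hw1.add hw2).const_mul
      (|symbolConst s| * (‖crossCLM‖ * SchwartzMap.seminorm ℝ 0 0 (𝓕 φ)))).mono'
      (continuous_prodWeight.measurable.smul (measurable_fourierField s φ)).aestronglyMeasurable
      (Filter.Eventually.of_forall fun ζ => ?_)
    rw [norm_smul, Real.norm_of_nonneg (prodWeight_pos ζ).le]
    refine (mul_le_mul_of_nonneg_left (norm_fourierField_le s φ ζ)
      (prodWeight_pos ζ).le).trans_eq ?_
    simp only [Pi.add_apply]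
    ring
  rw [locallyIntegrable_iff]
  intro K hK
  have hc : ContinuousOn (fun ζ => (prodWeight ζ)⁻¹) K :=
    (continuous_prodWeight.inv₀ fun ζ => (prodWeight_pos ζ).ne').continuousOn
  refine (hi.integrableOn.continuousOn_smul hc hK).congr
    (Filter.Eventually.of_forall fun ζ => ?_)
  simp only
  rw [smul_smul, inv_mul_cancel₀ (prodWeight_pos ζ).ne', one_smul]

/-! ### The almost everywhere formula and the change of Fourier kernel -/

theorem fourier_toLp_fracCurlAdj_ae {s : ℝ} (hs : s ∈ Set.Ioo (0 : ℝ) 1) (φ : 𝓢(R3, C3))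
    (hL : MemLp (fracCurlAdj s φ) 2 (volume : Measure R6)) :
    ∀ᵐ ζ, (𝓕 hL.toLp : Lp C3 2 (volume : Measure R6)) ζ = fourierField s φ ζ := by
  -- Two locally integrable fields agree almost everywhere once they agree against real smooth
  -- compactly supported functions; these are then viewed as complex Schwartz functions.
  refine ae_eq_of_integral_contDiff_smul_eq
    ((Lp.memLp (𝓕 hL.toLp : Lp C3 2 (volume : Measure R6))).locallyIntegrable one_le_two)
    (locallyIntegrable_fourierField hs φ) fun g g_smooth g_cpt => ?_
  have hg₁ : HasCompactSupport (Complex.ofRealCLM ∘ g) := g_cpt.comp_left rfl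
  have hg₂ : ContDiff ℝ (⊤ : ℕ∞) (Complex.ofRealCLM ∘ g) := by fun_prop
  have hg (ζ : R6) : hg₁.toSchwartzMap hg₂ ζ = (g ζ : ℂ) := rfl
  have h1 := DFunLike.congr_fun (Lp.fourier_toTemperedDistribution_eq hL.toLp)
    (hg₁.toSchwartzMap hg₂)
  have h3 := integral_fourier_smul_fracCurlAdj hs φ (hg₁.toSchwartzMap hg₂)
  rw [TemperedDistribution.fourier_apply, Lp.toTemperedDistribution_apply,
    Lp.toTemperedDistribution_apply] at h1
  have h2 : ∫ p, (𝓕 (hg₁.toSchwartzMap hg₂)) p •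
      (hL.toLp : Lp C3 2 (volume : Measure R6)) p =
      ∫ p, (𝓕 (hg₁.toSchwartzMap hg₂)) p • fracCurlAdj s φ p := by
    refine integral_congr_ae ?_
    filter_upwards [hL.coeFn_toLp] with p hp
    rw [hp]
  have h4 := h1.symm.trans (h2.trans h3)
  simp only [hg, Complex.coe_smul] at h4
  exact h4

/-- The symbol is homogeneous of degree `s - 3/2`; passing to the kernel `e^{-ix·ξ}` therefore only
changes the constant. -/
theorem fourierSymbol_smul (s : ℝ) {c : ℝ} (hc : 0 < c) (ζ : R6) :
    fourierSymbol s (c • ζ) = c ^ (s - 3 / 2) • fourierSymbol s ζ := by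
  have h : ∀ v : R3, (‖c • v‖ ^ ((3 : ℝ) / 2 + 1 - s))⁻¹ • c • v =
      c ^ (s - 3 / 2) • (‖v‖ ^ ((3 : ℝ) / 2 + 1 - s))⁻¹ • v := fun v => by
    rw [norm_smul, Real.norm_of_nonneg hc.le, Real.mul_rpow hc.le (norm_nonneg _), smul_smul,
      smul_smul, mul_inv, mul_right_comm, ← Real.rpow_neg hc.le, ← Real.rpow_add_one hc.ne']
    congr 3
    ring
  simp only [fourierSymbol, WithLp.smul_fst, WithLp.smul_snd, h, smul_add]

theorem fourierAngularL2_fracCurlAdj_ae {s : ℝ} (hs : s ∈ Set.Ioo (0 : ℝ) 1) (φ : 𝓢(R3, C3))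
    (hL : MemLp (fracCurlAdj s φ) 2 (volume : Measure R6)) :
    ∀ᵐ ζ : R6, fourierAngularL2 hL.toLp ζ =
      (((symbolConst s * (2 * Real.pi)⁻¹ ^ (s - 3 / 2) : ℝ) : ℂ) * Complex.I) •
        cross (complexVec (fourierSymbol s ζ)) (fourierAngular φ (ζ.fst + ζ.snd)) := by
  have hc : 0 < (2 * Real.pi)⁻¹ := by positivity
  have hq : Measure.QuasiMeasurePreserving (fun ζ : R6 => (2 * Real.pi)⁻¹ • ζ) volume volume :=
    Measure.quasiMeasurePreserving_smul volume hc.ne'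
  filter_upwards [hq.ae (fourier_toLp_fracCurlAdj_ae hs φ hL)] with ζ hζ
  rw [fourierAngularL2, hζ, fourierField, fourierSymbol_smul s hc, complexVec_smul,
    cross_real_smul_left, fourierAngular_eq, SchwartzMap.fourier_coe, WithLp.smul_fst,
    WithLp.smul_snd, ← smul_add, ← Complex.coe_smul, smul_smul]
  congr 1
  push_cast
  ring

/-! ### Boundedness on Bessel potential spaces -/

theorem besselSymbol_sumMap (t : ℝ) (ζ : R6) :
    besselSymbol sumMap t ζ =
      besselSymbol (ContinuousLinearMap.id ℝ R3) t (ζ.fst + ζ.snd) := by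
  rw [besselSymbol, besselSymbol, sumMap_apply, ContinuousLinearMap.id_apply, WithLp.smul_fst,
    WithLp.smul_snd, smul_add]

theorem fourierField_fourierMultiplierCLM (s t : ℝ) (φ : 𝓢(R3, C3)) (ζ : R6) :
    fourierField s (SchwartzMap.fourierMultiplierCLM C3
      (besselSymbol (ContinuousLinearMap.id ℝ R3) t) φ) ζ =
        besselSymbol sumMap t ζ • fourierField s φ ζ := by
  rw [fourierField, fourierField, fourier_fourierMultiplierCLM_apply (besselSymbol_temperate _ t),
    cross_smul_right, besselSymbol_sumMap, smul_comm]

theorem toTemperedDistribution_fracCurlAdj_apply {s : ℝ} {φ : R3 → C3}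
    (hL : MemLp (fracCurlAdj s φ) 2 (volume : Measure R6)) (u : 𝓢(R6, ℂ)) :
    (hL.toLp : 𝓢'(R6, C3)) u = ∫ p, u p • fracCurlAdj s φ p := by
  rw [Lp.toTemperedDistribution_apply]
  refine integral_congr_ae ?_
  filter_upwards [hL.coeFn_toLp] with p hp
  rw [hp]

/-- The adjoint fractional curl intertwines `⟨D⟩^t` with `⟨D_x + D_y⟩^t`. -/
theorem besselOp_sumMap_fracCurlAdj {s : ℝ} (hs : s ∈ Set.Ioo (0 : ℝ) 1) (t : ℝ)
    (φ : 𝓢(R3, C3)) :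
    besselOp C3 sumMap t ((memLp_fracCurlAdj hs φ).toLp : Lp C3 2 (volume : Measure R6)) =
      ((memLp_fracCurlAdj hs (SchwartzMap.fourierMultiplierCLM C3
        (besselSymbol (ContinuousLinearMap.id ℝ R3) t) φ)).toLp :
          Lp C3 2 (volume : Measure R6)) := by
  ext1 u
  rw [besselOp, fourierMultiplierCLM_apply_apply, toTemperedDistribution_fracCurlAdj_apply,
    toTemperedDistribution_fracCurlAdj_apply, integral_fourier_smul_fracCurlAdj hs]
  -- With `u` written as a Fourier transform, both sides become pairings on the frequency side,
  -- where the multiplier is pointwise.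
  have hu : 𝓕 (𝓕⁻ u) = u := fourier_fourierInv_eq u
  conv_rhs => rw [← hu, integral_fourier_smul_fracCurlAdj hs]
  refine integral_congr_ae (Filter.Eventually.of_forall fun ζ => ?_)
  simp only
  rw [fourierField_fourierMultiplierCLM,
    SchwartzMap.smulLeftCLM_apply_apply (besselSymbol_temperate sumMap t), smul_eq_mul, mul_comm,
    mul_smul]

/-- The adjoint fractional curl of Schwartz fields, as a linear map into `L²`. -/
def fracCurlAdjL2 {s : ℝ} (hs : s ∈ Set.Ioo (0 : ℝ) 1) :
    𝓢(R3, C3) →ₗ[ℂ] Lp C3 2 (volume : Measure R6) where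
  toFun φ := (memLp_fracCurlAdj hs φ).toLp
  map_add' φ ψ := by
    rw [← MemLp.toLp_add]
    refine MemLp.toLp_congr _ _ (Filter.Eventually.of_forall fun p => ?_)
    simp only [fracCurlAdj, _root_.add_apply, Pi.add_apply, ← crossCLM_apply, map_sub, map_add]
    abel
  map_smul' c φ := by
    rw [RingHom.id_apply, ← MemLp.toLp_const_smul]
    refine MemLp.toLp_congr _ _ (Filter.Eventually.of_forall fun p => ?_)
    simp only [fracCurlAdj, _root_.smul_apply, Pi.smul_apply, ← cross_smul_right, smul_sub]

/-- `K` extends `C*⟨D⟩^{-s}` from the dense Schwartz fields to `L²`, by the `H^s` bound. -/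
theorem exists_fracCurlAdj_comp_besselOp_neg {s : ℝ} (hs : s ∈ Set.Ioo (0 : ℝ) 1) :
    ∃ K : Lp C3 2 (volume : Measure R3) →L[ℂ] Lp C3 2 (volume : Measure R6), ∀ φ : 𝓢(R3, C3),
      K ((SchwartzMap.fourierMultiplierCLM C3
        (besselSymbol (ContinuousLinearMap.id ℝ R3) s) φ).toLp 2) = fracCurlAdjL2 hs φ := by
  obtain ⟨C, hC⟩ := exists_eLpNorm_fracCurlAdj_le hs
  let f : 𝓢(R3, C3) →ₗ[ℂ] Lp C3 2 (volume : Measure R6) := fracCurlAdjL2 hs ∘ₗ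
    (SchwartzMap.fourierMultiplierCLM C3
      (besselSymbol (ContinuousLinearMap.id ℝ R3) (-s))).toLinearMap
  let e : 𝓢(R3, C3) →ₗ[ℂ] Lp C3 2 (volume : Measure R3) :=
    (SchwartzMap.toLpCLM ℂ C3 2 volume).toLinearMap
  have he : DenseRange e := SchwartzMap.denseRange_toLpCLM (p := 2) ENNReal.ofNat_ne_top
  have hb : ∃ C, ∀ φ, ‖f φ‖ ≤ C * ‖e φ‖ := by
    refine ⟨C, fun ψ => ?_⟩
    have h := hC (SchwartzMap.fourierMultiplierCLM C3
      (besselSymbol (ContinuousLinearMap.id ℝ R3) (-s)) ψ)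
    rw [BesselSpace.fourierMultiplierCLM_besselSymbol_neg] at h
    change ‖(memLp_fracCurlAdj hs _).toLp‖ ≤ C * ‖(ψ.memLp 2 volume).toLp‖
    rw [Lp.norm_toLp, Lp.norm_toLp, ← ENNReal.coe_toReal, ← ENNReal.toReal_mul]
    exact ENNReal.toReal_mono (ENNReal.mul_ne_top ENNReal.coe_ne_top (ψ.memLp 2 volume).2.ne) h
  refine ⟨f.extendOfNorm e, fun φ => ?_⟩
  refine (LinearMap.extendOfNorm_eq he hb _).trans ?_
  change fracCurlAdjL2 hs _ = _
  congr 1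
  have h := BesselSpace.fourierMultiplierCLM_besselSymbol_neg
    (ℓ := ContinuousLinearMap.id ℝ R3) (r := -s) φ
  rwa [neg_neg] at h

/-- The extension is `⟨D_x + D_y⟩^{s-r} K ⟨D⟩^r`. On Schwartz fields `K⟨D⟩^r = C*⟨D⟩^{r-s} = ⟨D_x +
D_y⟩^{r-s} C*` by intertwining, so the outer factor cancels. -/
theorem exists_fracCurlAdj_sumSobolev {s : ℝ} (hs : s ∈ Set.Ioo (0 : ℝ) 1) (r : ℝ) :
    ∃ T : SobolevH R3 C3 r →L[ℂ] SumSobolev (r - s), ∀ φ : 𝓢(R3, C3),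
      (T (BesselSpace.ofSchwartz φ)).toDist = (fracCurlAdjL2 hs φ : 𝓢'(R6, C3)) := by
  obtain ⟨K, hK⟩ := exists_fracCurlAdj_comp_besselOp_neg hs
  refine ⟨(BesselSpace.toL2Equiv C3 sumMap (r - s)).symm.toContinuousLinearEquiv.toContinuousLinearMap
    ∘L K ∘L (BesselSpace.toL2Equiv C3 (ContinuousLinearMap.id ℝ R3)
      r).toContinuousLinearEquiv.toContinuousLinearMap, fun φ => ?_⟩
  change BesselSpace.toDist ((BesselSpace.toL2Equiv C3 sumMap (r - s)).symm
    (K (BesselSpace.toL2 (BesselSpace.ofSchwartz φ)))) = _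
  have h : SchwartzMap.fourierMultiplierCLM C3 (besselSymbol (ContinuousLinearMap.id ℝ R3) r) φ =
      SchwartzMap.fourierMultiplierCLM C3 (besselSymbol (ContinuousLinearMap.id ℝ R3) s)
        (SchwartzMap.fourierMultiplierCLM C3
          (besselSymbol (ContinuousLinearMap.id ℝ R3) (r - s)) φ) := by
    rw [SchwartzMap.fourierMultiplierCLM_fourierMultiplierCLM_apply (besselSymbol_temperate _ _)
      (besselSymbol_temperate _ _), besselSymbol_mul, add_sub_cancel]
  rw [BesselSpace.toDist_toL2Equiv_symm, BesselSpace.toL2_ofSchwartz, h, hK]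
  change besselOp C3 sumMap (-(r - s)) ((memLp_fracCurlAdj hs _).toLp :
    Lp C3 2 (volume : Measure R6)) = _
  rw [← besselOp_sumMap_fracCurlAdj hs, besselOp_neg_besselOp]
  rfl

/-- From `|ξ + η|² ≤ 2(|ξ|² + |η|²)`, raised to the nonnegative power `-t/2`. -/
theorem norm_besselSymbol_sumMap_mul_le {t : ℝ} (ht : t ≤ 0) (ζ : R6) :
    ‖besselSymbol sumMap (-t) ζ * besselSymbol (ContinuousLinearMap.id ℝ R6) t ζ‖ ≤
      2 ^ (-t / 2) := by
  generalize hη : (2 * Real.pi) • ζ = η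
  have h1 : 1 + ‖sumMap η‖ ^ 2 ≤ 2 * (1 + ‖η‖ ^ 2) := by
    rw [sumMap_apply, WithLp.prod_norm_sq_eq_of_L2]
    nlinarith [norm_add_le η.fst η.snd, norm_nonneg (η.fst + η.snd), norm_nonneg η.fst,
      norm_nonneg η.snd, sq_nonneg (‖η.fst‖ - ‖η.snd‖)]
  have h2 : (0 : ℝ) < 1 + ‖η‖ ^ 2 := by positivity
  rw [norm_mul, besselSymbol, besselSymbol, hη, Complex.norm_real, Complex.norm_real,
    Real.norm_of_nonneg (by positivity), Real.norm_of_nonneg (by positivity),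
    ContinuousLinearMap.id_apply]
  calc (1 + ‖sumMap η‖ ^ 2) ^ (-t / 2) * (1 + ‖η‖ ^ 2) ^ (t / 2)
      ≤ (2 * (1 + ‖η‖ ^ 2)) ^ (-t / 2) * (1 + ‖η‖ ^ 2) ^ (t / 2) := by
        gcongr
        linarith
    _ = 2 ^ (-t / 2) := by
        rw [Real.mul_rpow zero_le_two h2.le, mul_assoc, ← Real.rpow_add h2]
        ring_nf
        rw [Real.rpow_zero, mul_one]

theorem existsUnique_fracCurlAdj_extension {s : ℝ} (hs : s ∈ Set.Ioo (0 : ℝ) 1) {r t : ℝ}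
    {V : Type*} [NormedAddCommGroup V] [InnerProductSpace ℝ V] {ℓ : R6 →L[ℝ] V}
    (h : ∃ T : SobolevH R3 C3 r →L[ℂ] BesselSpace C3 ℓ t, ∀ φ : 𝓢(R3, C3),
      (T (BesselSpace.ofSchwartz φ)).toDist = (fracCurlAdjL2 hs φ : 𝓢'(R6, C3))) :
    ∃! T : SobolevH R3 C3 r →L[ℂ] BesselSpace C3 ℓ t,
      ∀ φ : 𝓢(R3, C3), HasCompactSupport φ →
        ∃ hL : MemLp (fracCurlAdj s φ) 2 (volume : Measure R6),
          (T (BesselSpace.ofSchwartz φ)).toDist =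
            (hL.toLp : Lp C3 2 (volume : Measure R6)) := by
  obtain ⟨T, hT⟩ := h
  refine ⟨T, fun φ _ => ⟨memLp_fracCurlAdj hs φ, hT φ⟩, fun T' hT' => ?_⟩
  refine DFunLike.coe_injective (T'.continuous.ext_on
    BesselSpace.dense_ofSchwartz_hasCompactSupport T.continuous ?_)
  rintro _ ⟨φ, hφ, rfl⟩
  obtain ⟨hL, h⟩ := hT' φ hφ
  exact BesselSpace.toDist_injective (h.trans (hT φ).symm)

theorem mainTheorem7 (s : ℝ) (hs : s ∈ Set.Ioo (0 : ℝ) 1) :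
    (∃ κ : ℝ, 0 < κ ∧ ∀ φ : 𝓢(R3, C3), HasCompactSupport φ →
      ∃ hL : MemLp (fracCurlAdj s φ) 2 (volume : Measure R6),
        ∀ᵐ ζ : R6, fourierAngularL2 hL.toLp ζ =
          (κ * Complex.I) •
            cross (complexVec ((‖ζ.fst‖ ^ ((3 : ℝ) / 2 + 1 - s))⁻¹ • ζ.fst +
                (‖ζ.snd‖ ^ ((3 : ℝ) / 2 + 1 - s))⁻¹ • ζ.snd))
              (fourierAngular φ (ζ.fst + ζ.snd))) ∧
    ∀ r ∈ Set.Ioo (0 : ℝ) (2 * s),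
      (∃! T : SobolevH R3 C3 r →L[ℂ] SumSobolev (r - s),
        ∀ φ : 𝓢(R3, C3), HasCompactSupport φ →
          ∃ hL : MemLp (fracCurlAdj s φ) 2 (volume : Measure R6),
            (T (BesselSpace.ofSchwartz φ)).toDist = (hL.toLp : Lp C3 2 (volume : Measure R6))) ∧
      (r ≤ s →
        ∃! T : SobolevH R3 C3 r →L[ℂ] SobolevH R6 C3 (r - s),
          ∀ φ : 𝓢(R3, C3), HasCompactSupport φ →
            ∃ hL : MemLp (fracCurlAdj s φ) 2 (volume : Measure R6),
              (T (BesselSpace.ofSchwartz φ)).toDist =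
                (hL.toLp : Lp C3 2 (volume : Measure R6))) := by
  -- The power of `(2π)⁻¹` is the homogeneity factor from rescaling the frequencies.
  refine ⟨⟨symbolConst s * (2 * Real.pi)⁻¹ ^ (s - 3 / 2), ?_, fun φ _ =>
    ⟨memLp_fracCurlAdj hs φ, fourierAngularL2_fracCurlAdj_ae hs φ _⟩⟩, fun r _ =>
    ⟨existsUnique_fracCurlAdj_extension hs (exists_fracCurlAdj_sumSobolev hs r), fun hr =>
      existsUnique_fracCurlAdj_extension hs ?_⟩⟩
  · have := symbolConst_pos hs
    positivity
  · obtain ⟨T, hT⟩ := exists_fracCurlAdj_sumSobolev hs r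
    obtain ⟨J, hJ⟩ := BesselSpace.exists_inclusion (F := C3)
      (norm_besselSymbol_sumMap_mul_le (sub_nonpos.mpr hr))
    exact ⟨J ∘L T, fun φ => (hJ _).trans (hT φ)⟩

end
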